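/- **Setting.** Consider $\dot x=f(x)+g(x)u$ with $x\in\mathcal X$, $\mathcal X\subseteq\mathbb R^n$ open, $u\in\mathbb R^m$, where $f:\mathcal X\to\mathbb R^n$ and $g:\mathcal X\to\mathbb R^{n\times m}$ are $C^1$ and $\operatorname{rank} g(x)=m$ on $\mathcal X$. For $F:\mathcal X\to\mathbb R^k$, $\nabla F$ is the $n\times k$ matrix with entries $\partial F_j/\partial x_i$, and $\dot F:=(\nabla F)^\top(f+gu)$. A subscript $*$ denotes evaluation at $x_*$, and $\|v\|_A^2=v^\top Av$. Let $x_*\in\mathcal X$ be an assignable equilibrium, i.e. $\nu^\top f(x_*)=0$ for every $\nu\in\mathbb R^n$ with $\nu^\top g(x_*)=0$, and put $\kappa:=(g_*^\top g_*)^{-1}g_*^\top f_*$. *Assumption 1.* $S:\mathcal X\to\mathbb R$ is $C^2$, $\ell:\mathcal X\to\mathbb R^r$, and $(\nabla S)^\top f=-\|\ell\|^2$ on $\mathcal X$. *Assumption 2.* For some $w:\mathcal X\to\mathbb R^{r\times m}$, $D:\mathcal X\to\mathbb R^{m\times m}$ with $D^\top=-D$, let $y:=g^\top\nabla S+2w^\top\ell+(w^\top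 w+D)u$. There are a $C^2$ map $\gamma:\mathcal X\to\mathbb R^m$ and constants $\alpha_i,\beta_i>0$ such that $\dot\gamma=y$ for all $(x,u)\in\mathcal X\times\mathbb R^m$, $(\nabla S)_*+(\nabla\gamma)_*\kappa=0$, and $$(\nabla^2S)_*+\sum_{i=1}^m\alpha_i\beta_i(\nabla\gamma_i)_*(\nabla\gamma_i)_*^\top+(\nabla^2(\gamma^\top\kappa))_*>0 .$$ *Assumption 3.* There are $s$ with $1\le s\le n-m$, a $C^1$ map $\eta:\mathcal X\to\mathbb R^s$ and continuous, diagonal positive definite matrix functions $\Lambda_\ell:\mathcal X\to\mathbb R^{s\times s}$, $\Lambda_c:\mathcal X\to\mathbb R^{m\times m}$ with $(\nabla\gamma)^\top\nabla\eta=0$ on $\mathcal X$ and $-\|\ell+wu\|^2\le-\|\dot\eta\|^2_{\Lambda_\ell}-\|y\|^2_{\Lambda_c}$ for all $(x,u)\in\mathcal X\times\mathbb R^m$. *Controller.* Fix $\alpha_c=\alpha$, $\beta_c=\beta$. Let $\alpha_{\ell_i},\beta_{\ell_i}>0$, let $\Upsilon\in\mathbb R^{m\times s}$ have rank $\min\{m,s\}$,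 let $K_\ell,R_\ell\in\mathbb R^{m\times m}$ be diagonal positive definite and $K_c,R_c\in\mathbb R^{m\times m}$ symmetric positive definite. With controller states $x_\ell,x_c\in\mathbb R^m$ let $$z_\ell=\Upsilon(\eta(x)-\eta_*)+K_\ell x_\ell,\qquad z_c=\gamma(x)-\gamma_*+x_c,\qquad \Phi_\bullet(z)=\sum_{i=1}^m\frac{\alpha_{\bullet_i}}{\beta_{\bullet_i}}\ln\cosh(\beta_{\bullet_i}z_i)\quad(\bullet\in\{\ell,c\}),$$ $$u=-\kappa-\nabla\Phi_\ell(z_\ell)-\nabla\Phi_c(z_c),\qquad \dot x_\ell=-R_\ell\sum_{i=1}^me_i\alpha_{\ell_i}\tanh(\beta_{\ell_i}z_{\ell_i}),\qquad \dot x_c=-R_c\Big[\sum_{i=1}^me_i\alpha_{c_i}\tanh(\beta_{c_i}z_{c_i})+K_cx_c\Big].$$ Put $$\Theta(x)=\begin{bmatrix}\Lambda_\ell(x)&0&\tfrac12\Upsilon^\top R_\ell^{-1}\\0&\Lambda_c(x)&-\tfrac12R_\ell^{-1}\\\tfrac12R_\ell^{-1}\Upsilon&-\tfrac12R_\ell^{-1}&K_\ell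 R_\ell^{-1}\end{bmatrix},$$ $$S_{d_c}=S(x)+\Phi_c(z_c)+\kappa^\top\gamma(x)+\tfrac12\|x_c\|_{K_c}^2,\qquad S_{d_\ell}=S_{d_c}+\Phi_\ell(z_\ell).$$ **Proposition.** Under Assumptions 1–3: (i) For all such controller parameters and all states in $\mathcal X\times\mathbb R^m\times\mathbb R^m$, $u_i\in[-\kappa_i-\alpha_{\ell_i}-\alpha_{c_i},\,-\kappa_i+\alpha_{\ell_i}+\alpha_{c_i}]$. (ii) For every admissible $\Upsilon$ there is $c>0$ such that $\Theta(x)>0$ for all $x$ near $x_*$ whenever $(K_\ell R_\ell)_{ii}\ge c$ for all $i$. There is a positive definite $K_0$ such that for every $K_c$ with $K_c-K_0\ge0$ and all other admissible parameters for which $\Theta(x)\ge0$ for all $x$ near $x_*$, the point $(x_*,0,0)$ (in the order $(x,x_\ell,x_c)$) is a (Lyapunov) stable equilibrium of the closed loop, and $S_{d_\ell}$ is a Lyapunov function for it: on an open neighbourhood of $(x_*,0,0)$ it is $C^1$, has a strict minimum exactly at $(x_*,0,0)$, and its derivative along the closed loop is $\le0$. (iii) If moreover $\Theta(x)>0$ for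 all $x$ near $x_*$, then $(x_*,0,0)$ is locally asymptotically stable provided that the following detectability condition holds on some open set $\Omega_d\subseteq\mathcal X\times\mathbb R^m\times\mathbb R^m$ containing $(x_*,0,0)$: the only closed-loop solution on $[0,\infty)$ that stays in $\Omega_d$ and satisfies $\dot\eta=0$, $y=0$, $\dot x_\ell=0$, $\dot x_c=0$ for all $t\ge0$ is the constant $(x_*,0,0)$. (In particular, this holds if these four equations, read as equations in $(x,x_\ell,x_c)\in\Omega_d$, imply $x=x_*$, $x_\ell=0$, $x_c=0$.) -/

import Mathlib

open Matrix Set Filter Topology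

noncomputable section

namespace SatControl

/-! Column vectors are functions `Fin k → ℝ`. Only their topology is used; Euclidean (weighted)
norms are written out as `v ⬝ᵥ v` and `v ⬝ᵥ A *ᵥ v`. -/

/-- The gradient of a scalar function. -/
def grad {n : ℕ} (φ : (Fin n → ℝ) → ℝ) (x : Fin n → ℝ) : Fin n → ℝ :=
  fun i => fderiv ℝ φ x (Pi.single i 1)

/-- The `n × k` matrix with entries `∂F_j / ∂x_i` (columns are the gradients of the `F_j`). -/
def jac {n k : ℕ} (F : (Fin n → ℝ) → Fin k → ℝ) (x : Fin n → ℝ) : Matrix (Fin n) (Fin k) ℝ :=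
  Matrix.of fun i j => grad (fun z => F z j) x i

/-- The Hessian matrix of a scalar function. -/
def hess {n : ℕ} (φ : (Fin n → ℝ) → ℝ) (x : Fin n → ℝ) : Matrix (Fin n) (Fin n) ℝ :=
  jac (grad φ) x

/-! ### Stability notions for an autonomous system `q' = F q` on an open set `U` -/

section Stability

variable {E : Type*} [NormedAddCommGroup E] [NormedSpace ℝ E]

/-- `ξ` is a solution of `q' = F q` on the time set `J` that lives in `U`. -/
def IsSolution (F : E → E) (U : Set E) (J : Set ℝ) (ξ : ℝ → E) : Prop :=
  IsIntegralCurveOn ξ (fun _ => F) J ∧ ∀ t ∈ J, ξ t ∈ U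

/-- `p` is a (locally, Lyapunov) stable equilibrium: for every neighbourhood `N` of `p` there is a
neighbourhood `M` of `p` from each point of which a solution exists for all `t ≥ 0`, and such that
every solution that starts in `M` stays in `N` as long as it is defined. -/
def IsStableEquilibrium (F : E → E) (U : Set E) (p : E) : Prop :=
  p ∈ U ∧ F p = 0 ∧
    ∀ N ∈ 𝓝 p, ∃ M ∈ 𝓝 p,
      (∀ q ∈ M, ∃ ξ : ℝ → E, ξ 0 = q ∧ IsSolution F U (Ici 0) ξ) ∧
      ∀ (T : ℝ) (ξ : ℝ → E), IsSolution F U (Icc 0 T) ξ → ξ 0 ∈ M → ∀ t ∈ Icc 0 T, ξ t ∈ N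

/-- `p` is a locally asymptotically stable equilibrium: stable and locally attractive. -/
def IsAsympStableEquilibrium (F : E → E) (U : Set E) (p : E) : Prop :=
  IsStableEquilibrium F U p ∧
    ∃ M ∈ 𝓝 p, ∀ ξ : ℝ → E, IsSolution F U (Ici 0) ξ → ξ 0 ∈ M → Tendsto ξ atTop (𝓝 p)

/-- `V` is a (weak) Lyapunov function for `p`: on an open neighbourhood of `p` it is continuously
differentiable, `V - V p` is positive definite with respect to `p`, and the derivative of `V` along
the vector field is nonpositive. -/
def IsLyapunovFunction (F : E → E) (U : Set E) (p : E) (V : E → ℝ) : Prop :=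
  ∃ N : Set E, IsOpen N ∧ p ∈ N ∧ N ⊆ U ∧ ContDiffOn ℝ 1 V N ∧
    (∀ q ∈ N, q ≠ p → V p < V q) ∧ ∀ q ∈ N, fderiv ℝ V q (F q) ≤ 0

end Stability

/-! ### The plant and the standing assumptions -/

/-- The input-affine system `x' = f x + g x u` with state space `X` (open in `ℝⁿ`), `m` inputs and
`g` of full column rank; `f` and `g` are continuously differentiable. -/
structure Plant (n m : ℕ) where
  X : Set (Fin n → ℝ)
  f : (Fin n → ℝ) → Fin n → ℝ
  g : (Fin n → ℝ) → Matrix (Fin n) (Fin m) ℝ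
  isOpen_X : IsOpen X
  contDiffOn_f : ContDiffOn ℝ 1 f X
  contDiffOn_g : ∀ i j, ContDiffOn ℝ 1 (fun x => g x i j) X
  rank_g : ∀ x ∈ X, (g x).rank = m

namespace Plant

variable {n m r s : ℕ}

/-- The open-loop velocity `x' = f x + g x u`. -/
def velocity (P : Plant n m) (x : Fin n → ℝ) (u : Fin m → ℝ) : Fin n → ℝ :=
  P.f x + P.g x *ᵥ u

/-- The assignable equilibria: `g⊥(x) f(x) = 0`, i.e. every row vector annihilating `g x` from the
left also annihilates `f x`. -/
def assignable (P : Plant n m) : Set (Fin n → ℝ) :=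
  {x | x ∈ P.X ∧ ∀ v : Fin n → ℝ, v ᵥ* P.g x = 0 → v ⬝ᵥ P.f x = 0}

/-- `κ = (g_*ᵀ g_*)⁻¹ g_*ᵀ f_*`. -/
def kappa (P : Plant n m) (xs : Fin n → ℝ) : Fin m → ℝ :=
  (((P.g xs)ᵀ * P.g xs)⁻¹ * (P.g xs)ᵀ) *ᵥ P.f xs

/-- The passive output `y = gᵀ ∇S + 2 wᵀ ℓ + (wᵀ w + D) u`. -/
def output (P : Plant n m) (S : (Fin n → ℝ) → ℝ) (l : (Fin n → ℝ) → Fin r → ℝ)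
    (w : (Fin n → ℝ) → Matrix (Fin r) (Fin m) ℝ) (D : (Fin n → ℝ) → Matrix (Fin m) (Fin m) ℝ)
    (x : Fin n → ℝ) (u : Fin m → ℝ) : Fin m → ℝ :=
  (P.g x)ᵀ *ᵥ grad S x + (2 : ℝ) • ((w x)ᵀ *ᵥ l x) + ((w x)ᵀ * w x + D x) *ᵥ u

/-- The time derivative of a function `F` of the state: `(∇F)ᵀ (f + g u)`. -/
def rate {k : ℕ} (P : Plant n m) (F : (Fin n → ℝ) → Fin k → ℝ)
    (x : Fin n → ℝ) (u : Fin m → ℝ) : Fin k → ℝ :=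
  (jac F x)ᵀ *ᵥ P.velocity x u

/-- `[∇S]ᵀ f = -‖ℓ‖²` on the state space. -/
structure Assumption1 (P : Plant n m) (S : (Fin n → ℝ) → ℝ)
    (l : (Fin n → ℝ) → Fin r → ℝ) : Prop where
  contDiffOn_S : ContDiffOn ℝ 2 S P.X
  dissipation : ∀ x ∈ P.X, grad S x ⬝ᵥ P.f x = -(l x ⬝ᵥ l x)

/-- The output `y` built from `S`, `ℓ`, `w` and the skew-symmetric `D` is integrable, `γ' = y`, and
the shaped storage function has a critical point with positive definite Hessian at the assignable
point `xs`. -/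
structure Assumption2 (P : Plant n m) (S : (Fin n → ℝ) → ℝ) (l : (Fin n → ℝ) → Fin r → ℝ)
    (w : (Fin n → ℝ) → Matrix (Fin r) (Fin m) ℝ) (D : (Fin n → ℝ) → Matrix (Fin m) (Fin m) ℝ)
    (γ : (Fin n → ℝ) → Fin m → ℝ) (α β : Fin m → ℝ) (xs : Fin n → ℝ) : Prop where
  assignable : xs ∈ P.assignable
  skew : ∀ x ∈ P.X, (D x)ᵀ = -D x
  contDiffOn_γ : ContDiffOn ℝ 2 γ P.X
  rate_γ : ∀ x ∈ P.X, ∀ u, P.rate γ x u = P.output S l w D x u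
  α_pos : ∀ i, 0 < α i
  β_pos : ∀ i, 0 < β i
  critical : grad S xs + jac γ xs *ᵥ P.kappa xs = 0
  hessian : (hess S xs
      + ∑ i, (α i * β i) • vecMulVec (grad (fun x => γ x i) xs) (grad (fun x => γ x i) xs)
      + hess (fun x => γ x ⬝ᵥ P.kappa xs) xs).PosDef

/-- Natural damping in the coordinates `η`, decoupled from `γ`. The diagonal positive definite
matrices `Λ_ℓ(x)`, `Λ_c(x)` are given by their diagonals. -/
structure Assumption3 (P : Plant n m) (S : (Fin n → ℝ) → ℝ) (l : (Fin n → ℝ) → Fin r → ℝ)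
    (w : (Fin n → ℝ) → Matrix (Fin r) (Fin m) ℝ) (D : (Fin n → ℝ) → Matrix (Fin m) (Fin m) ℝ)
    (γ : (Fin n → ℝ) → Fin m → ℝ) (η : (Fin n → ℝ) → Fin s → ℝ)
    (Λl : (Fin n → ℝ) → Fin s → ℝ) (Λc : (Fin n → ℝ) → Fin m → ℝ) : Prop where
  one_le : 1 ≤ s
  le_sub : s + m ≤ n
  contDiffOn_η : ContDiffOn ℝ 1 η P.X
  continuousOn_Λl : ContinuousOn Λl P.X
  continuousOn_Λc : ContinuousOn Λc P.X
  Λl_pos : ∀ x ∈ P.X, ∀ i, 0 < Λl x i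
  Λc_pos : ∀ x ∈ P.X, ∀ i, 0 < Λc x i
  decoupled : ∀ x ∈ P.X, (jac γ x)ᵀ * jac η x = 0
  damping : ∀ x ∈ P.X, ∀ u : Fin m → ℝ,
    -((l x + w x *ᵥ u) ⬝ᵥ (l x + w x *ᵥ u)) ≤
      -(P.rate η x u ⬝ᵥ diagonal (Λl x) *ᵥ P.rate η x u)
      - P.output S l w D x u ⬝ᵥ diagonal (Λc x) *ᵥ P.output S l w D x u

end Plant

/-! ### The saturated dynamic controller -/

/-- The controller parameters. `kl` and `rl` are the diagonals of the diagonal matrices `K_ℓ`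
and `R_ℓ`. -/
structure Gains (m s : ℕ) where
  αc : Fin m → ℝ
  βc : Fin m → ℝ
  αl : Fin m → ℝ
  βl : Fin m → ℝ
  Υ : Matrix (Fin m) (Fin s) ℝ
  kl : Fin m → ℝ
  rl : Fin m → ℝ
  Kc : Matrix (Fin m) (Fin m) ℝ
  Rc : Matrix (Fin m) (Fin m) ℝ

/-- The constraints on the controller parameters, including `α_c = α` and `β_c = β`. -/
structure Gains.Admissible {m s : ℕ} (G : Gains m s) (α β : Fin m → ℝ) : Prop where
  αc_eq : G.αc = α
  βc_eq : G.βc = β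
  αl_pos : ∀ i, 0 < G.αl i
  βl_pos : ∀ i, 0 < G.βl i
  rank_Υ : G.Υ.rank = min m s
  kl_pos : ∀ i, 0 < G.kl i
  rl_pos : ∀ i, 0 < G.rl i
  Kc_posDef : G.Kc.PosDef
  Rc_posDef : G.Rc.PosDef

/-- `Φ(z) = ∑ (a_i / b_i) ln cosh (b_i z_i)`. -/
def logCosh {m : ℕ} (a b z : Fin m → ℝ) : ℝ :=
  ∑ i, a i / b i * Real.log (Real.cosh (b i * z i))

/-- The saturation `∑ e_i a_i tanh (b_i z_i)`. -/
def sat {m : ℕ} (a b z : Fin m → ℝ) : Fin m → ℝ :=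
  fun i => a i * Real.tanh (b i * z i)

/-- The closed-loop state `(x, x_ℓ, x_c)`. -/
abbrev State (n m : ℕ) : Type := (Fin n → ℝ) × (Fin m → ℝ) × (Fin m → ℝ)

section ClosedLoop

variable {n m r s : ℕ}

/-- `z_ℓ = Υ (η(x) - η_*) + K_ℓ x_ℓ`. -/
def zl (η : (Fin n → ℝ) → Fin s → ℝ) (xs : Fin n → ℝ) (G : Gains m s) (q : State n m) :
    Fin m → ℝ :=
  G.Υ *ᵥ (η q.1 - η xs) + diagonal G.kl *ᵥ q.2.1

/-- `z_c = γ(x) - γ_* + x_c`. -/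
def zc (γ : (Fin n → ℝ) → Fin m → ℝ) (xs : Fin n → ℝ) (q : State n m) : Fin m → ℝ :=
  γ q.1 - γ xs + q.2.2

/-- `u = -κ - ∇Φ_ℓ(z_ℓ) - ∇Φ_c(z_c)`. -/
def control (P : Plant n m) (γ : (Fin n → ℝ) → Fin m → ℝ) (η : (Fin n → ℝ) → Fin s → ℝ)
    (xs : Fin n → ℝ) (G : Gains m s) (q : State n m) : Fin m → ℝ :=
  -P.kappa xs - grad (logCosh G.αl G.βl) (zl η xs G q) - grad (logCosh G.αc G.βc) (zc γ xs q)

/-- `x_ℓ' = -R_ℓ ∑ e_i α_{ℓ i} tanh (β_{ℓ i} z_{ℓ i})`. -/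
def xlDot (η : (Fin n → ℝ) → Fin s → ℝ) (xs : Fin n → ℝ) (G : Gains m s) (q : State n m) :
    Fin m → ℝ :=
  -(diagonal G.rl *ᵥ sat G.αl G.βl (zl η xs G q))

/-- `x_c' = -R_c (∑ e_i α_{c i} tanh (β_{c i} z_{c i}) + K_c x_c)`. -/
def xcDot (γ : (Fin n → ℝ) → Fin m → ℝ) (xs : Fin n → ℝ) (G : Gains m s) (q : State n m) :
    Fin m → ℝ :=
  -(G.Rc *ᵥ (sat G.αc G.βc (zc γ xs q) + G.Kc *ᵥ q.2.2))

/-- The closed-loop vector field. -/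
def closedLoop (P : Plant n m) (γ : (Fin n → ℝ) → Fin m → ℝ) (η : (Fin n → ℝ) → Fin s → ℝ)
    (xs : Fin n → ℝ) (G : Gains m s) (q : State n m) : State n m :=
  (P.velocity q.1 (control P γ η xs G q), xlDot η xs G q, xcDot γ xs G q)

/-- The closed-loop state space `X × ℝᵐ × ℝᵐ`. -/
def stateSpace (P : Plant n m) : Set (State n m) := {q | q.1 ∈ P.X}

/-- `S_{dc} = S + Φ_c(z_c) + κᵀ γ + ½ ‖x_c‖²_{K_c}`. -/
def Sdc (P : Plant n m) (S : (Fin n → ℝ) → ℝ) (γ : (Fin n → ℝ) → Fin m → ℝ)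
    (xs : Fin n → ℝ) (G : Gains m s) (q : State n m) : ℝ :=
  S q.1 + logCosh G.αc G.βc (zc γ xs q) + P.kappa xs ⬝ᵥ γ q.1
    + 1 / 2 * (q.2.2 ⬝ᵥ G.Kc *ᵥ q.2.2)

/-- `S_{dℓ} = S_{dc} + Φ_ℓ(z_ℓ)`. -/
def Sdl (P : Plant n m) (S : (Fin n → ℝ) → ℝ) (γ : (Fin n → ℝ) → Fin m → ℝ)
    (η : (Fin n → ℝ) → Fin s → ℝ) (xs : Fin n → ℝ) (G : Gains m s) (q : State n m) : ℝ :=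
  Sdc P S γ xs G q + logCosh G.αl G.βl (zl η xs G q)

/-- The symmetric block matrix
`Θ = [Λ_ℓ, 0, ½ Υᵀ R_ℓ⁻¹; 0, Λ_c, -½ R_ℓ⁻¹; ½ R_ℓ⁻¹ Υ, -½ R_ℓ⁻¹, K_ℓ R_ℓ⁻¹]`, for the values
`lam`, `mu` of the diagonals of `Λ_ℓ`, `Λ_c` at a point. -/
def Theta (lam : Fin s → ℝ) (mu : Fin m → ℝ) (Υ : Matrix (Fin m) (Fin s) ℝ) (kl rl : Fin m → ℝ) :
    Matrix ((Fin s ⊕ Fin m) ⊕ Fin m) ((Fin s ⊕ Fin m) ⊕ Fin m) ℝ :=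
  fromBlocks
    (fromBlocks (diagonal lam) 0 0 (diagonal mu))
    (fromRows ((1 / 2 : ℝ) • (Υᵀ * (diagonal rl)⁻¹)) (-((1 / 2 : ℝ) • (diagonal rl)⁻¹)))
    (fromCols ((1 / 2 : ℝ) • ((diagonal rl)⁻¹ * Υ)) (-((1 / 2 : ℝ) • (diagonal rl)⁻¹)))
    (diagonal kl * (diagonal rl)⁻¹)

/-- Detectability on `Ω`: the only closed-loop trajectory in `Ω` along which
`η' = 0`, `y = 0`, `x_ℓ' = 0`, `x_c' = 0` hold identically is the constant `(xs, 0, 0)`. In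
particular, this is the case if these four equations at a point of `Ω` force that point to be
`(xs, 0, 0)`. -/
def Detectable (P : Plant n m) (S : (Fin n → ℝ) → ℝ) (l : (Fin n → ℝ) → Fin r → ℝ)
    (w : (Fin n → ℝ) → Matrix (Fin r) (Fin m) ℝ) (D : (Fin n → ℝ) → Matrix (Fin m) (Fin m) ℝ)
    (γ : (Fin n → ℝ) → Fin m → ℝ) (η : (Fin n → ℝ) → Fin s → ℝ)
    (xs : Fin n → ℝ) (G : Gains m s) (Ω : Set (State n m)) : Prop :=
  ∀ ξ : ℝ → State n m, IsSolution (closedLoop P γ η xs G) Ω (Ici 0) ξ →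
    (∀ t ∈ Ici (0 : ℝ),
      P.rate η (ξ t).1 (control P γ η xs G (ξ t)) = 0 ∧
      P.output S l w D (ξ t).1 (control P γ η xs G (ξ t)) = 0 ∧
      xlDot η xs G (ξ t) = 0 ∧
      xcDot γ xs G (ξ t) = 0) →
    ∀ t ∈ Ici (0 : ℝ), ξ t = (xs, 0, 0)

end ClosedLoop

end SatControl

end

namespace SatControl

section Dynamics

variable {E : Type*} [NormedAddCommGroup E] [NormedSpace ℝ E]

/-- A bounded Lipschitz vector field has an integral curve through every point. -/
theorem exists_isIntegralCurve_of_lipschitz [CompleteSpace E] {G : E → E} {K L : NNReal}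
    (hK : LipschitzWith K G) (hL : ∀ q, ‖G q‖ ≤ L) (q : E) :
    ∃ ξ : ℝ → E, ξ 0 = q ∧ ∀ t, HasDerivAt ξ (G (ξ t)) t := by
  have key : ∀ T : NNReal, ∃ ξ : ℝ → E, ξ 0 = q ∧
      ∀ t ∈ Ioo (-(T : ℝ)) T, HasDerivAt ξ (G (ξ t)) t := by
    intro T
    have h0 : (0 : ℝ) ∈ Icc (-(T : ℝ)) T := ⟨by simp, T.2⟩
    have hPL : IsPicardLindelof (fun _ => G) (⟨0, h0⟩ : Icc (-(T : ℝ)) T) q (L * T) 0 L K :=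
      { lipschitzOnWith := fun _ _ => hK.lipschitzOnWith
        continuousOn := fun _ _ => continuousOn_const
        norm_le := fun _ _ x _ => hL x
        mul_max_le := by simp }
    obtain ⟨ξ, hξ0, hξ⟩ := hPL.exists_eq_forall_mem_Icc_hasDerivWithinAt₀
    exact ⟨ξ, hξ0, fun t ht => (hξ t (Ioo_subset_Icc_self ht)).hasDerivAt
      (Icc_mem_nhds ht.1 ht.2)⟩
  choose α hα0 hα using key
  have agree : ∀ T₁ T₂ : NNReal, T₁ ≤ T₂ → EqOn (α T₁) (α T₂) (Ioo (-(T₁ : ℝ)) T₁) := by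
    intro T₁ T₂ h12
    rcases eq_or_lt_of_le (zero_le : 0 ≤ T₁) with h | h
    · simp [← h]
    · have h12' : (T₁ : ℝ) ≤ T₂ := h12
      have hpos : (0 : ℝ) < T₁ := h
      refine ODE_solution_unique_of_mem_Ioo (v := fun _ => G) (s := fun _ => univ) (t₀ := 0)
        (fun _ _ => hK.lipschitzOnWith) ⟨by linarith, hpos⟩
        (fun t ht => ⟨hα _ t ht, mem_univ _⟩)
        (fun t ht => ⟨hα _ t ⟨by linarith [ht.1], by linarith [ht.2]⟩, mem_univ _⟩) ?_
      rw [hα0, hα0]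
  let R : ℝ → NNReal := fun t => ⟨|t| + 1, by positivity⟩
  have hR : ∀ t, (R t : ℝ) = |t| + 1 := fun t => rfl
  refine ⟨fun t => α (R t) t, hα0 _, fun t => ?_⟩
  have ht : t ∈ Ioo (-(R t : ℝ)) (R t) := by
    rw [hR]; constructor <;> linarith [neg_abs_le t, le_abs_self t]
  refine (hα (R t) t ht).congr_of_eventuallyEq ?_
  filter_upwards [Ioo_mem_nhds ht.1 ht.2] with s hs
  have hs' : s ∈ Ioo (-(R s : ℝ)) (R s) := by
    rw [hR]; constructor <;> linarith [neg_abs_le s, le_abs_self s]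
  rcases le_total (R s) (R t) with h | h
  · exact agree _ _ h hs'
  · exact (agree _ _ h hs).symm

/-- A `C¹` vector field agrees near a point with a bounded globally Lipschitz one. -/
theorem exists_lipschitz_eqOn_closedBall [FiniteDimensional ℝ E] {F : E → E} {U : Set E}
    (hU : IsOpen U) (hF : ContDiffOn ℝ 1 F U) {p : E} {ρ : ℝ} (hρ : 0 < ρ)
    (hball : Metric.closedBall p (2 * ρ) ⊆ U) :
    ∃ (G : E → E) (K L : NNReal), LipschitzWith K G ∧ (∀ q, ‖G q‖ ≤ L) ∧
      EqOn G F (Metric.closedBall p ρ) := by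
  let χ : ContDiffBump p := ⟨ρ, 2 * ρ, hρ, by linarith⟩
  have hsupp : HasCompactSupport fun q => χ q • F q := χ.hasCompactSupport.smul_right
  have hsm : ContDiff ℝ 1 fun q => χ q • F q := by
    rw [contDiff_iff_contDiffAt]
    intro q
    by_cases hq : q ∈ U
    · exact χ.contDiffAt.smul (hF.contDiffAt (hU.mem_nhds hq))
    · have hq' : q ∉ tsupport χ := fun h => hq (hball (by rwa [χ.tsupport_eq] at h))
      have hz : (fun q => χ q • F q) =ᶠ[𝓝 q] fun _ => 0 := by
        filter_upwards [notMem_tsupport_iff_eventuallyEq.1 hq'] with z hz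
        simp [hz]
      exact contDiffAt_const.congr_of_eventuallyEq hz
  obtain ⟨K, hK⟩ := hsm.lipschitzWith_of_hasCompactSupport hsupp one_ne_zero
  obtain ⟨L, hL⟩ := hsupp.exists_bound_of_continuous hsm.continuous
  refine ⟨_, K, L.toNNReal, hK, fun q => (hL q).trans (Real.le_coe_toNNReal L), fun q hq => ?_⟩
  have : χ q = 1 := χ.one_of_mem_closedBall hq
  simp [this]

/-- A function whose derivative along `F` is nonpositive decreases along the curves of `F`. -/
theorem antitoneOn_comp_of_fderiv_nonpos {F : E → E} {V : E → ℝ} {C : Set E} {J : Set ℝ}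
    (hJ : Convex ℝ J) (hd : ∀ q ∈ C, DifferentiableAt ℝ V q)
    (hV : ∀ q ∈ C, fderiv ℝ V q (F q) ≤ 0) {ξ : ℝ → E}
    (hξ : ∀ t ∈ J, HasDerivWithinAt ξ (F (ξ t)) J t) (hC : ∀ t ∈ J, ξ t ∈ C) :
    AntitoneOn (fun t => V (ξ t)) J := by
  have h : ∀ t ∈ J, HasDerivWithinAt (fun t => V (ξ t)) (fderiv ℝ V (ξ t) (F (ξ t))) J t :=
    fun t ht => (hd _ (hC t ht)).hasFDerivAt.comp_hasDerivWithinAt t (hξ t ht)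
  have h' : ∀ t ∈ interior J, HasDerivAt (fun t => V (ξ t)) (fderiv ℝ V (ξ t) (F (ξ t))) t :=
    fun t ht => (h t (interior_subset ht)).hasDerivAt (mem_interior_iff_mem_nhds.1 ht)
  refine antitoneOn_of_deriv_nonpos hJ (fun t ht => (h t ht).continuousWithinAt)
    (fun t ht => (h' t ht).differentiableAt.differentiableWithinAt) fun t ht => ?_
  rw [(h' t ht).deriv]
  exact hV _ (hC t (interior_subset ht))

/-- Curves cannot leave a ball through a sphere on which the Lyapunov function is too large. -/
theorem mem_ball_of_lyapunov {F : E → E} {V : E → ℝ} {p : E} {ρ c T : ℝ}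
    (hd : ∀ q ∈ Metric.closedBall p ρ, DifferentiableAt ℝ V q)
    (hV : ∀ q ∈ Metric.closedBall p ρ, fderiv ℝ V q (F q) ≤ 0)
    (hc : ∀ q ∈ Metric.sphere p ρ, c ≤ V q) {ξ : ℝ → E}
    (hcont : ContinuousOn ξ (Icc 0 T))
    (hξ : ∀ t ∈ Icc 0 T, ξ t ∈ Metric.closedBall p ρ →
      HasDerivWithinAt ξ (F (ξ t)) (Icc 0 T) t)
    (h0 : ξ 0 ∈ Metric.ball p ρ) (h0c : V (ξ 0) < c) :
    ∀ t ∈ Icc 0 T, ξ t ∈ Metric.ball p ρ := by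
  have hdist : ContinuousOn (fun t => dist (ξ t) p) (Icc 0 T) :=
    (continuous_id.dist continuous_const).comp_continuousOn hcont
  have ivt : ∀ t ∈ Icc 0 T, ρ ≤ dist (ξ t) p → ∃ s ∈ Icc 0 t, dist (ξ s) p = ρ := by
    intro t ht hρ
    exact intermediate_value_Icc ht.1 (hdist.mono (Icc_subset_Icc_right ht.2))
      ⟨(Metric.mem_ball.1 h0).le, hρ⟩
  by_contra! hcon
  obtain ⟨t₁, ht₁, hout⟩ := hcon
  obtain ⟨t₂, ht₂, ht₂'⟩ := ivt t₁ ht₁ (by simpa using hout)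
  have hA : IsCompact {t ∈ Icc 0 T | dist (ξ t) p = ρ} := by
    refine isCompact_Icc.of_isClosed_subset ?_ (fun t ht => ht.1)
    exact hdist.preimage_isClosed_of_isClosed isClosed_Icc (isClosed_singleton (x := ρ))
  obtain ⟨τ, ⟨hτ, hτρ⟩, hmin⟩ := hA.exists_isLeast ⟨t₂, ⟨ht₂.1, ht₂.2.trans ht₁.2⟩, ht₂'⟩
  have hin : ∀ t ∈ Icc 0 τ, ξ t ∈ Metric.closedBall p ρ := by
    intro t ht
    by_contra hlt
    have hlt' : ρ < dist (ξ t) p := by simpa using hlt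
    have htT : t ≤ T := ht.2.trans hτ.2
    obtain ⟨s, hs, hsρ⟩ := ivt t ⟨ht.1, htT⟩ hlt'.le
    have h1 : τ ≤ s := hmin ⟨⟨hs.1, hs.2.trans htT⟩, hsρ⟩
    have h2 : s = t := le_antisymm hs.2 (ht.2.trans h1)
    rw [h2] at hsρ
    exact hlt'.ne' hsρ
  have hsub : Icc 0 τ ⊆ Icc 0 T := Icc_subset_Icc_right hτ.2
  have hanti := antitoneOn_comp_of_fderiv_nonpos (convex_Icc 0 τ) hd hV
    (fun t ht => (hξ t (hsub ht) (hin t ht)).mono hsub) hin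
  have h1 := hanti (left_mem_Icc.2 hτ.1) (right_mem_Icc.2 hτ.1) hτ.1
  have h2 := hc (ξ τ) hτρ
  simp only at h1
  linarith

/-- The invariance principle for a precompact curve of a Lipschitz vector field: if `V` decreases
along the curve, then every limit point starts a curve along which `V` is constant. -/
theorem tendsto_of_invariance {G : E → E} {K : NNReal} (hK : LipschitzWith K G)
    (hex : ∀ q, ∃ ζ : ℝ → E, ζ 0 = q ∧ ∀ t, HasDerivAt ζ (G (ζ t)) t)
    {C : Set E} (hC : IsCompact C) {V : E → ℝ} (hVc : ContinuousOn V C) {p : E} {ξ : ℝ → E}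
    (hξ : ∀ t ∈ Ici (0 : ℝ), HasDerivWithinAt ξ (G (ξ t)) (Ici 0) t)
    (hmem : ∀ t ∈ Ici (0 : ℝ), ξ t ∈ C) (hanti : AntitoneOn (fun t => V (ξ t)) (Ici 0))
    (huniq : ∀ ζ : ℝ → E, (∀ t, HasDerivAt ζ (G (ζ t)) t) →
      (∀ t ∈ Ici (0 : ℝ), ζ t ∈ C) → (∀ t ∈ Ici (0 : ℝ), V (ζ t) = V (ζ 0)) → ζ 0 = p) :
    Tendsto ξ atTop (𝓝 p) := by
  refine hC.tendsto_nhds_of_unique_mapClusterPt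
    ((eventually_ge_atTop 0).mono hmem) fun q hq hcl => ?_
  obtain ⟨𝒰, h𝒰, hlim⟩ := mapClusterPt_iff_ultrafilter.1 hcl
  obtain ⟨ζ, hζ0, hζ⟩ := hex q
  have hζc : Continuous ζ := continuous_iff_continuousAt.2 fun t => (hζ t).continuousAt
  have hconv : ∀ t ∈ Ici (0 : ℝ), Tendsto (fun s => ξ (s + t)) 𝒰 (𝓝 (ζ t)) := by
    intro t ht
    rw [tendsto_iff_dist_tendsto_zero]
    have hd : Tendsto (fun s => dist (ξ s) q * Real.exp (K * (t - 0))) 𝒰 (𝓝 0) := by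
      simpa using (tendsto_iff_dist_tendsto_zero.1 hlim).mul_const (Real.exp (K * (t - 0)))
    refine squeeze_zero' (Eventually.of_forall fun _ => dist_nonneg) ?_ hd
    filter_upwards [h𝒰 (eventually_ge_atTop (0 : ℝ))] with s hs
    have hder : ∀ r ∈ Ici (0 : ℝ),
        HasDerivWithinAt (fun r => ξ (s + r)) (G (ξ (s + r))) (Ici r) r := by
      intro r hr
      have h1 : HasDerivWithinAt (fun r : ℝ => s + r) 1 (Ici r) r :=
        ((hasDerivAt_id r).const_add s).hasDerivWithinAt
      have h2 := (hξ (s + r) (add_nonneg hs hr)).scomp r h1 (fun x hx =>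
        add_nonneg hs (le_trans hr hx))
      simpa [Function.comp_def] using h2
    have hcont : ContinuousOn (fun r => ξ (s + r)) (Icc 0 t) := by
      intro r hr
      have h2 : ContinuousWithinAt ξ (Ici 0) (s + r) :=
        (hξ (s + r) (add_nonneg hs hr.1)).continuousWithinAt
      exact h2.comp (by fun_prop) fun x hx => add_nonneg hs hx.1
    exact dist_le_of_trajectories_ODE (v := fun _ => G) (a := 0) (b := t) (fun _ => hK)
      hcont (fun r hr => hder r hr.1) hζc.continuousOn (fun r _ => (hζ r).hasDerivWithinAt)
      (by simp [hζ0]) t (right_mem_Icc.2 ht)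
  have hζC : ∀ t ∈ Ici (0 : ℝ), ζ t ∈ C := fun t ht =>
    hC.isClosed.mem_of_tendsto (hconv t ht) (((eventually_ge_atTop 0).filter_mono h𝒰).mono
      fun s hs => hmem _ (add_nonneg hs ht))
  obtain ⟨b, hb⟩ := hC.bddBelow_image hVc
  have hanti' : Antitone fun t => V (ξ (max t 0)) := fun a a' h =>
    hanti (mem_Ici.2 (le_max_right _ _)) (mem_Ici.2 (le_max_right _ _)) (max_le_max_right 0 h)
  have hL := tendsto_atTop_ciInf hanti' ⟨b, by
    rintro _ ⟨t, rfl⟩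
    exact hb ⟨_, hmem _ (mem_Ici.2 (le_max_right _ _)), rfl⟩⟩
  have hVL : ∀ t ∈ Ici (0 : ℝ), V (ζ t) = ⨅ t, V (ξ (max t 0)) := by
    intro t ht
    have h1 : Tendsto (fun s => V (ξ (s + t))) 𝒰 (𝓝 (V (ζ t))) := by
      refine (hVc _ (hζC t ht)).tendsto.comp (tendsto_nhdsWithin_iff.2 ⟨hconv t ht, ?_⟩)
      exact ((eventually_ge_atTop 0).filter_mono h𝒰).mono
        fun s hs => hmem _ (add_nonneg hs ht)
    have h2 : Tendsto (fun s : ℝ => V (ξ (max (s + t) 0))) 𝒰 (𝓝 (⨅ t, V (ξ (max t 0)))) :=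
      (hL.comp (tendsto_atTop_add_const_right _ t tendsto_id)).mono_left h𝒰
    refine tendsto_nhds_unique (h1.congr' ?_) h2
    filter_upwards [h𝒰 (eventually_ge_atTop (0 : ℝ))] with s hs
    rw [max_eq_left (add_nonneg hs ht)]
  rw [← hζ0]
  exact huniq ζ hζ hζC fun t ht => (hVL t ht).trans (hVL 0 self_mem_Ici).symm

variable [FiniteDimensional ℝ E] {F : E → E} {U : Set E} {p : E} {V : E → ℝ}

/-- Arbitrarily small balls around `p` trap all curves starting close enough to `p`, and there the
vector field extends to a bounded Lipschitz one. -/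
theorem IsLyapunovFunction.exists_trapping (hU : IsOpen U) (hF : ContDiffOn ℝ 1 F U)
    (hV : IsLyapunovFunction F U p V) {N : Set E} (hN : N ∈ 𝓝 p) :
    ∃ ρ > 0, Metric.closedBall p ρ ⊆ N ∩ U ∧
      (∀ q ∈ Metric.closedBall p ρ, DifferentiableAt ℝ V q ∧ fderiv ℝ V q (F q) ≤ 0) ∧
      (∃ (G : E → E) (K L : NNReal), LipschitzWith K G ∧ (∀ q, ‖G q‖ ≤ L) ∧
        EqOn G F (Metric.closedBall p ρ)) ∧
      ∃ M ∈ 𝓝 p, ∀ (T : ℝ) (ξ : ℝ → E), ContinuousOn ξ (Icc 0 T) →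
        (∀ t ∈ Icc 0 T, ξ t ∈ Metric.closedBall p ρ →
          HasDerivWithinAt ξ (F (ξ t)) (Icc 0 T) t) → ξ 0 ∈ M →
        ∀ t ∈ Icc 0 T, ξ t ∈ Metric.ball p ρ := by
  obtain ⟨W, hWo, hpW, hWU, hVW, hmin, hdec⟩ := hV
  obtain ⟨ε, hε, hεW⟩ := Metric.mem_nhds_iff.1 (inter_mem hN (hWo.mem_nhds hpW))
  have hρ : 0 < ε / 3 := by linarith
  have hsub : Metric.closedBall p (2 * (ε / 3)) ⊆ N ∩ W :=
    (Metric.closedBall_subset_ball (by linarith)).trans hεW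
  have hsub' : Metric.closedBall p (ε / 3) ⊆ N ∩ W :=
    (Metric.closedBall_subset_closedBall (by linarith)).trans hsub
  have hdiff : ∀ q ∈ W, DifferentiableAt ℝ V q := fun q hq =>
    (hVW.contDiffAt (hWo.mem_nhds hq)).differentiableAt one_ne_zero
  have hd : ∀ q ∈ Metric.closedBall p (ε / 3),
      DifferentiableAt ℝ V q ∧ fderiv ℝ V q (F q) ≤ 0 := fun q hq =>
    ⟨hdiff q (hsub' hq).2, hdec q (hsub' hq).2⟩
  refine ⟨ε / 3, hρ, fun q hq => ⟨(hsub' hq).1, hWU (hsub' hq).2⟩, hd,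
    exists_lipschitz_eqOn_closedBall hU hF hρ (fun q hq => hWU (hsub hq).2), ?_⟩
  obtain ⟨c, hpc, hc⟩ : ∃ c, V p < c ∧ ∀ q ∈ Metric.sphere p (ε / 3), c ≤ V q := by
    rcases (Metric.sphere p (ε / 3)).eq_empty_or_nonempty with he | hne
    · exact ⟨V p + 1, by linarith, by simp [he]⟩
    · have hcont : ContinuousOn V (Metric.sphere p (ε / 3)) :=
        hVW.continuousOn.mono fun q hq => (hsub' (Metric.sphere_subset_closedBall hq)).2
      obtain ⟨q, hq, hqmin⟩ := (isCompact_sphere p (ε / 3)).exists_isMinOn hne hcont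
      refine ⟨V q, hmin q (hsub' (Metric.sphere_subset_closedBall hq)).2 ?_, fun z hz => hqmin hz⟩
      rintro rfl
      simp at hq
      linarith
  refine ⟨Metric.ball p (ε / 3) ∩ {q | V q < c}, inter_mem (Metric.ball_mem_nhds p hρ)
    ((hdiff p hpW).continuousAt.eventually_lt continuousAt_const hpc), ?_⟩
  intro T ξ hcont hξ h0
  exact mem_ball_of_lyapunov (fun q hq => (hd q hq).1) (fun q hq => (hd q hq).2) hc hcont hξ
    h0.1 h0.2

/-- **Lyapunov's stability theorem.** -/
theorem IsLyapunovFunction.isStableEquilibrium (hU : IsOpen U) (hF : ContDiffOn ℝ 1 F U)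
    (hp : F p = 0) (hV : IsLyapunovFunction F U p V) : IsStableEquilibrium F U p := by
  have hpU : p ∈ U := by
    obtain ⟨W, -, hpW, hWU, -⟩ := hV
    exact hWU hpW
  refine ⟨hpU, hp, fun N hN => ?_⟩
  obtain ⟨ρ, hρ, hsub, -, ⟨G, K, L, hK, hL, hGF⟩, M, hM, htrap⟩ := hV.exists_trapping hU hF hN
  refine ⟨M, hM, fun q hq => ?_, fun T ξ hξ h0 t ht => ?_⟩
  · obtain ⟨ξ, hξ0, hξ⟩ := exists_isIntegralCurve_of_lipschitz hK hL q
    have hin : ∀ t ∈ Ici (0 : ℝ), ξ t ∈ Metric.closedBall p ρ := fun t ht =>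
      Metric.ball_subset_closedBall <| htrap t ξ
        (fun s _ => (hξ s).continuousAt.continuousWithinAt)
        (fun s _ hs => hGF hs ▸ (hξ s).hasDerivWithinAt) (hξ0 ▸ hq) t (right_mem_Icc.2 ht)
    refine ⟨ξ, hξ0, fun t ht => ?_, fun t ht => (hsub (hin t ht)).2⟩
    have h := hξ t
    rw [hGF (hin t ht)] at h
    exact h.hasDerivWithinAt
  · exact (hsub (Metric.ball_subset_closedBall
      (htrap T ξ hξ.1.continuousOn (fun s hs _ => hξ.1 s hs) h0 t ht))).1

/-- **The Barbashin–Krasovskii–LaSalle theorem.** -/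
theorem IsLyapunovFunction.isAsympStableEquilibrium (hU : IsOpen U) (hF : ContDiffOn ℝ 1 F U)
    (hp : F p = 0) (hV : IsLyapunovFunction F U p V) {Ω : Set E} (hΩ : Ω ∈ 𝓝 p)
    (hinv : ∀ ζ : ℝ → E, IsSolution F Ω (Ici 0) ζ →
      (∀ t ∈ Ici (0 : ℝ), fderiv ℝ V (ζ t) (F (ζ t)) = 0) → ζ 0 = p) :
    IsAsympStableEquilibrium F U p := by
  refine ⟨hV.isStableEquilibrium hU hF hp, ?_⟩
  obtain ⟨ρ, hρ, hsub, hd, ⟨G, K, L, hK, hL, hGF⟩, M, hM, htrap⟩ := hV.exists_trapping hU hF hΩ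
  refine ⟨M, hM, fun ξ hξ h0 => ?_⟩
  have hin : ∀ t ∈ Ici (0 : ℝ), ξ t ∈ Metric.closedBall p ρ := fun t ht =>
    Metric.ball_subset_closedBall <| htrap t ξ
      (hξ.1.continuousOn.mono Icc_subset_Ici_self)
      (fun s hs _ => (hξ.1 s hs.1).mono Icc_subset_Ici_self) h0 t (right_mem_Icc.2 ht)
  refine tendsto_of_invariance hK (exists_isIntegralCurve_of_lipschitz hK hL)
    (isCompact_closedBall p ρ) (fun q hq => (hd q hq).1.continuousAt.continuousWithinAt)
    (fun t ht => by rw [hGF (hin t ht)]; exact hξ.1 t ht) hin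
    (antitoneOn_comp_of_fderiv_nonpos (convex_Ici 0) (fun q hq => (hd q hq).1)
      (fun q hq => (hd q hq).2) hξ.1 hin) fun ζ hζ hζin hconst => ?_
  have hζF : ∀ t ∈ Ici (0 : ℝ), HasDerivAt ζ (F (ζ t)) t := fun t ht =>
    hGF (hζin t ht) ▸ hζ t
  refine hinv ζ ⟨fun t ht => (hζF t ht).hasDerivWithinAt, fun t ht => (hsub (hζin t ht)).1⟩
    fun t ht => ?_
  have h1 : HasDerivWithinAt (fun t => V (ζ t)) (fderiv ℝ V (ζ t) (F (ζ t))) (Ici t) t :=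
    ((hd _ (hζin t ht)).1.hasFDerivAt.comp_hasDerivAt t (hζF t ht)).hasDerivWithinAt
  have h2 : HasDerivWithinAt (fun t => V (ζ t)) 0 (Ici t) t :=
    (hasDerivWithinAt_const t (Ici t) (V (ζ 0))).congr
      (fun s hs => hconst s (mem_Ici.2 (le_trans ht hs))) (hconst t ht)
  exact (uniqueDiffOn_Ici t t self_mem_Ici).eq_deriv _ h1 h2

end Dynamics

end SatControl

namespace SatControl

/-- The second-order sufficient condition for a strict local minimum. -/
theorem eventually_lt_of_fderiv_fderiv_pos {E : Type*} [NormedAddCommGroup E] [NormedSpace ℝ E]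
    [FiniteDimensional ℝ E] {W : E → ℝ} {p : E} (hW : ContDiffAt ℝ 2 W p)
    (h1 : fderiv ℝ W p = 0) (h2 : ∀ v, v ≠ 0 → 0 < fderiv ℝ (fderiv ℝ W) p v v) :
    ∀ᶠ q in 𝓝 p, q ≠ p → W p < W q := by
  set B := fderiv ℝ (fderiv ℝ W) p with hB
  obtain ⟨c, hc, hcB⟩ : ∃ c > 0, ∀ v, c * ‖v‖ ^ 2 ≤ B v v := by
    rcases (Metric.sphere (0 : E) 1).eq_empty_or_nonempty with he | hne
    · refine ⟨1, one_pos, fun v => ?_⟩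
      have hv : v = 0 := by
        by_contra hv
        have : ‖v‖⁻¹ • v ∈ Metric.sphere (0 : E) 1 := by simp [norm_smul, hv]
        rw [he] at this
        exact this
      simp [hv]
    · have hcont : Continuous fun v => B v v := by fun_prop
      obtain ⟨e, he, hmin⟩ := (isCompact_sphere (0 : E) 1).exists_isMinOn hne hcont.continuousOn
      have he0 : e ≠ 0 := by
        rintro rfl
        simp at he
      refine ⟨B e e, h2 e he0, fun v => ?_⟩
      rcases eq_or_ne v 0 with rfl | hv
      · simp
      · have hn : ‖v‖ ≠ 0 := norm_ne_zero_iff.2 hv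
        have h3 : B e e ≤ B (‖v‖⁻¹ • v) (‖v‖⁻¹ • v) :=
          hmin (show ‖v‖⁻¹ • v ∈ Metric.sphere (0 : E) 1 by simp [norm_smul, hv])
        simp only [map_smul, _root_.smul_apply, smul_eq_mul] at h3
        calc B e e * ‖v‖ ^ 2 ≤ ‖v‖⁻¹ * (‖v‖⁻¹ * B v v) * ‖v‖ ^ 2 := by gcongr
          _ = B v v := by field_simp
  have hdd : HasFDerivAt (fderiv ℝ W) B p :=
    ((hW.fderiv_right (m := 1) (by norm_num)).differentiableAt one_ne_zero).hasFDerivAt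
  have hlo := (hasFDerivAt_iff_isLittleO.1 hdd).def (half_pos hc)
  have hd : ∀ᶠ q in 𝓝 p, DifferentiableAt ℝ W q :=
    (hW.eventually (by simp)).mono fun q hq => hq.differentiableAt two_ne_zero
  obtain ⟨ε, hε, hball⟩ := Metric.eventually_nhds_iff_ball.1 (hlo.and hd)
  filter_upwards [Metric.ball_mem_nhds p hε] with q hq hqp
  set v := q - p with hv
  have hv0 : 0 < ‖v‖ := norm_pos_iff.2 (sub_ne_zero.2 hqp)
  have hvε : ‖v‖ < ε := by rwa [hv, ← dist_eq_norm]
  have hmem : ∀ t ∈ Icc (0 : ℝ) 1, p + t • v ∈ Metric.ball p ε := by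
    intro t ht
    rw [Metric.mem_ball, dist_self_add_left, norm_smul, Real.norm_of_nonneg ht.1]
    exact (mul_le_of_le_one_left hv0.le ht.2).trans_lt hvε
  have hder : ∀ t ∈ Icc (0 : ℝ) 1,
      HasDerivAt (fun t : ℝ => W (p + t • v)) (fderiv ℝ W (p + t • v) v) t := by
    intro t ht
    have h4 : HasDerivAt (fun t : ℝ => p + t • v) v t := by
      simpa using ((hasDerivAt_id t).smul_const v).const_add p
    exact (hball _ (hmem t ht)).2.hasFDerivAt.comp_hasDerivAt t h4
  obtain ⟨t, ht, hslope⟩ := exists_hasDerivAt_eq_slope (fun t : ℝ => W (p + t • v))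
    (fun t => fderiv ℝ W (p + t • v) v) zero_lt_one
    (fun t ht => (hder t ht).continuousAt.continuousWithinAt)
    (fun t ht => hder t (Ioo_subset_Icc_self ht))
  have h5 := (hball _ (hmem t (Ioo_subset_Icc_self ht))).1
  rw [h1, add_sub_cancel_left, sub_zero, norm_smul, Real.norm_of_nonneg ht.1.le] at h5
  have h6 := (ContinuousLinearMap.le_opNorm (fderiv ℝ W (p + t • v) - B (t • v)) v).trans
    (mul_le_mul_of_nonneg_right h5 hv0.le)
  have h7 := (abs_le.1 (Real.norm_eq_abs _ ▸ h6)).1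
  simp only [map_smul, _root_.sub_apply, _root_.smul_apply,
    smul_eq_mul] at h7
  have h8 := mul_le_mul_of_nonneg_left (hcB v) ht.1.le
  have h9 : 0 < t * (c * ‖v‖ ^ 2) := mul_pos ht.1 (by positivity)
  have h10 : W q - W p = fderiv ℝ W (p + t • v) v := by
    rw [hslope]; simp [hv]
  nlinarith

section Gradient

variable {n m k : ℕ}

theorem clm_apply_eq_dotProduct (L : (Fin n → ℝ) →L[ℝ] ℝ) (v : Fin n → ℝ) :
    L v = (fun i => L (Pi.single i 1)) ⬝ᵥ v := by
  conv_lhs => rw [pi_eq_sum_univ' v]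
  simp [dotProduct, mul_comm]

theorem fderiv_apply_eq_grad_dotProduct (φ : (Fin n → ℝ) → ℝ) (x v : Fin n → ℝ) :
    fderiv ℝ φ x v = grad φ x ⬝ᵥ v :=
  clm_apply_eq_dotProduct _ v

theorem jac_transpose_mulVec_apply (F : (Fin n → ℝ) → Fin k → ℝ) (x v : Fin n → ℝ) (j : Fin k) :
    ((jac F x)ᵀ *ᵥ v) j = grad (fun z => F z j) x ⬝ᵥ v := rfl

theorem hasDerivAt_comp_grad {φ : (Fin n → ℝ) → ℝ} {c : ℝ → Fin n → ℝ} {c' : Fin n → ℝ} {t : ℝ}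
    (hφ : DifferentiableAt ℝ φ (c t)) (hc : HasDerivAt c c' t) :
    HasDerivAt (fun t => φ (c t)) (grad φ (c t) ⬝ᵥ c') t := by
  rw [← fderiv_apply_eq_grad_dotProduct]
  exact hφ.hasFDerivAt.comp_hasDerivAt t hc

theorem hasDerivAt_comp_jac {F : (Fin n → ℝ) → Fin k → ℝ} {c : ℝ → Fin n → ℝ} {c' : Fin n → ℝ}
    {t : ℝ} (hF : DifferentiableAt ℝ F (c t)) (hc : HasDerivAt c c' t) :
    HasDerivAt (fun t => F (c t)) ((jac F (c t))ᵀ *ᵥ c') t :=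
  hasDerivAt_pi.2 fun j => hasDerivAt_comp_grad (differentiableAt_pi.1 hF j) hc

theorem differentiableAt_grad {φ : (Fin n → ℝ) → ℝ} {x : Fin n → ℝ} (hφ : ContDiffAt ℝ 2 φ x) :
    DifferentiableAt ℝ (grad φ) x := by
  have h : DifferentiableAt ℝ (fderiv ℝ φ) x :=
    (hφ.fderiv_right (m := 1) (by norm_num)).differentiableAt one_ne_zero
  exact differentiableAt_pi.2 fun i => h.clm_apply (differentiableAt_const _)

theorem hasDerivAt_dotProduct {f g : ℝ → Fin k → ℝ} {f' g' : Fin k → ℝ} {t : ℝ}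
    (hf : HasDerivAt f f' t) (hg : HasDerivAt g g' t) :
    HasDerivAt (fun t => f t ⬝ᵥ g t) (f' ⬝ᵥ g t + f t ⬝ᵥ g') t := by
  simp only [dotProduct, ← Finset.sum_add_distrib]
  exact HasDerivAt.fun_sum fun i _ => (hasDerivAt_pi.1 hf i).mul (hasDerivAt_pi.1 hg i)

theorem hasDerivAt_mulVec (A : Matrix (Fin m) (Fin k) ℝ) {f : ℝ → Fin k → ℝ} {f' : Fin k → ℝ}
    {t : ℝ} (hf : HasDerivAt f f' t) : HasDerivAt (fun t => A *ᵥ f t) (A *ᵥ f') t :=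
  (Matrix.mulVecLin A).toContinuousLinearMap.hasFDerivAt.comp_hasDerivAt t hf

theorem grad_dotProduct_const {F : (Fin n → ℝ) → Fin k → ℝ} {x : Fin n → ℝ}
    (hF : DifferentiableAt ℝ F x) (v : Fin k → ℝ) :
    grad (fun z => F z ⬝ᵥ v) x = jac F x *ᵥ v := by
  have h : HasFDerivAt (fun z => F z ⬝ᵥ v) (∑ j, v j • fderiv ℝ (fun z => F z j) x) x := by
    simp only [dotProduct]
    exact HasFDerivAt.fun_sum fun j _ =>
      (differentiableAt_pi.1 hF j).hasFDerivAt.mul_const (v j)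
  ext i
  change fderiv ℝ (fun z => F z ⬝ᵥ v) x (Pi.single i 1) = _
  rw [h.fderiv]
  simp [grad, jac, mulVec, dotProduct, mul_comm]

end Gradient

section Saturation

variable {m : ℕ} (a b : Fin m → ℝ)

theorem hasDerivAt_log_cosh (y : ℝ) :
    HasDerivAt (fun y => Real.log (Real.cosh y)) (Real.tanh y) y := by
  rw [Real.tanh_eq_sinh_div_cosh]
  exact (Real.hasDerivAt_cosh y).log (Real.cosh_pos y).ne'

theorem contDiff_tanh {k : WithTop ℕ∞} : ContDiff ℝ k Real.tanh := by
  rw [show Real.tanh = fun y => Real.sinh y / Real.cosh y from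
    funext Real.tanh_eq_sinh_div_cosh]
  exact Real.contDiff_sinh.div Real.contDiff_cosh fun y => (Real.cosh_pos y).ne'

theorem hasDerivAt_tanh_zero : HasDerivAt Real.tanh 1 0 := by
  rw [show Real.tanh = fun y => Real.sinh y / Real.cosh y from
    funext Real.tanh_eq_sinh_div_cosh]
  have h := (Real.hasDerivAt_sinh 0).div (Real.hasDerivAt_cosh 0) (Real.cosh_pos 0).ne'
  simp only [Real.cosh_zero, Real.sinh_zero, mul_one, mul_zero, sub_zero, one_pow, div_one] at h
  exact h

theorem contDiff_logCosh {k : WithTop ℕ∞} : ContDiff ℝ k (logCosh a b) := by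
  refine ContDiff.sum fun i _ => contDiff_const.mul (ContDiff.log ?_ fun z => (Real.cosh_pos _).ne')
  exact Real.contDiff_cosh.comp (contDiff_const.mul (contDiff_apply ℝ ℝ i))

theorem contDiff_sat {k : WithTop ℕ∞} : ContDiff ℝ k (sat a b) :=
  contDiff_pi.2 fun i => contDiff_const.mul
    (contDiff_tanh.comp (contDiff_const.mul (contDiff_apply ℝ ℝ i)))

variable {a b}

theorem hasDerivAt_logCosh (hb : ∀ i, 0 < b i) {z : ℝ → Fin m → ℝ} {z' : Fin m → ℝ} {t : ℝ}
    (hz : HasDerivAt z z' t) :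
    HasDerivAt (fun t => logCosh a b (z t)) (sat a b (z t) ⬝ᵥ z') t := by
  refine HasDerivAt.fun_sum fun i _ => ?_
  refine (((hasDerivAt_log_cosh (b i * z t i)).comp t
    ((hasDerivAt_pi.1 hz i).const_mul (b i))).const_mul (a i / b i)).congr_deriv ?_
  have := (hb i).ne'
  simp only [sat]
  field_simp

theorem grad_logCosh (hb : ∀ i, 0 < b i) (z : Fin m → ℝ) : grad (logCosh a b) z = sat a b z := by
  ext i
  have h1 : HasDerivAt (fun t : ℝ => z + t • (Pi.single i 1 : Fin m → ℝ)) (Pi.single i 1) 0 := by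
    simpa using ((hasDerivAt_id (0 : ℝ)).smul_const (Pi.single i 1 : Fin m → ℝ)).const_add z
  have h2 := hasDerivAt_logCosh (a := a) hb h1
  have h3 := hasDerivAt_comp_grad (φ := logCosh a b)
    ((contDiff_logCosh (k := 1) a b).differentiable one_ne_zero _) h1
  simpa using h3.unique h2

theorem hasDerivAt_sat_of_eq_zero {z : ℝ → Fin m → ℝ} {z' : Fin m → ℝ} {t : ℝ}
    (hz : HasDerivAt z z' t) (h0 : z t = 0) :
    HasDerivAt (fun t => sat a b (z t)) (fun i => a i * b i * z' i) t := by
  refine hasDerivAt_pi.2 fun i => ?_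
  have h1 : HasDerivAt Real.tanh 1 (b i * z t i) := by
    simpa [h0] using hasDerivAt_tanh_zero
  refine ((h1.comp t ((hasDerivAt_pi.1 hz i).const_mul (b i))).const_mul (a i)).congr_deriv ?_
  ring

@[simp]
theorem sat_zero : sat a b 0 = 0 := by
  ext i
  simp [sat]

@[simp]
theorem logCosh_zero : logCosh a b 0 = 0 := by
  simp [logCosh]

theorem logCosh_nonneg (ha : ∀ i, 0 < a i) (hb : ∀ i, 0 < b i) (z : Fin m → ℝ) :
    0 ≤ logCosh a b z :=
  Finset.sum_nonneg fun i _ => mul_nonneg (div_pos (ha i) (hb i)).le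
    (Real.log_nonneg (Real.one_le_cosh _))

theorem logCosh_pos (ha : ∀ i, 0 < a i) (hb : ∀ i, 0 < b i) {z : Fin m → ℝ} (hz : z ≠ 0) :
    0 < logCosh a b z := by
  obtain ⟨i, hi⟩ := Function.ne_iff.1 hz
  refine Finset.sum_pos' (fun i _ => mul_nonneg (div_pos (ha i) (hb i)).le
    (Real.log_nonneg (Real.one_le_cosh _))) ⟨i, Finset.mem_univ i, ?_⟩
  exact mul_pos (div_pos (ha i) (hb i)) (Real.log_pos (Real.one_lt_cosh.2
    (mul_ne_zero (hb i).ne' hi)))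

theorem abs_sat_le (ha : ∀ i, 0 < a i) (z : Fin m → ℝ) (i : Fin m) : |sat a b z i| ≤ a i := by
  rw [sat, abs_mul, abs_of_pos (ha i)]
  exact mul_le_of_le_one_right (ha i).le
    (abs_le.2 ⟨(Real.neg_one_lt_tanh _).le, (Real.tanh_lt_one _).le⟩)

end Saturation

end SatControl

namespace SatControl

section Matrices

variable {m n s : ℕ}

theorem dotProduct_diagonal_mulVec_self (d v : Fin m → ℝ) :
    v ⬝ᵥ diagonal d *ᵥ v = ∑ i, d i * v i ^ 2 := by
  simp only [dotProduct, mulVec_diagonal]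
  exact Finset.sum_congr rfl fun i _ => by ring

theorem inv_diagonal_of_pos {r : Fin m → ℝ} (hr : ∀ i, 0 < r i) :
    (diagonal r)⁻¹ = diagonal fun i => (r i)⁻¹ := by
  refine Matrix.inv_eq_left_inv ?_
  rw [diagonal_mul_diagonal, ← diagonal_one]
  exact congrArg diagonal (funext fun i => inv_mul_cancel₀ (hr i).ne')

theorem isHermitian_Theta (lam : Fin s → ℝ) (mu : Fin m → ℝ) (Υ : Matrix (Fin m) (Fin s) ℝ)
    (kl : Fin m → ℝ) {rl : Fin m → ℝ} (hr : ∀ i, 0 < rl i) :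
    (Theta lam mu Υ kl rl).IsHermitian := by
  rw [Theta, inv_diagonal_of_pos hr, diagonal_mul_diagonal]
  refine IsHermitian.fromBlocks (IsHermitian.fromBlocks ?_ (by simp) ?_) ?_ ?_
  · exact isHermitian_diagonal lam
  · exact isHermitian_diagonal mu
  · ext i j
    rcases j with j | j
    · simp [mul_comm]
    · by_cases h : i = j
      · simp [h]
      · simp [h, Ne.symm h]
  · exact isHermitian_diagonal _

theorem dotProduct_Theta_mulVec (lam : Fin s → ℝ) (mu : Fin m → ℝ) (Υ : Matrix (Fin m) (Fin s) ℝ)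
    (kl : Fin m → ℝ) {rl : Fin m → ℝ} (hr : ∀ i, 0 < rl i) (a : Fin s → ℝ) (b v : Fin m → ℝ) :
    Sum.elim (Sum.elim a b) (diagonal rl *ᵥ v) ⬝ᵥ
        Theta lam mu Υ kl rl *ᵥ Sum.elim (Sum.elim a b) (diagonal rl *ᵥ v) =
      a ⬝ᵥ diagonal lam *ᵥ a + b ⬝ᵥ diagonal mu *ᵥ b + v ⬝ᵥ Υ *ᵥ a - v ⬝ᵥ b
        + ∑ i, kl i * rl i * v i ^ 2 := by
  have h1 : (diagonal rl)⁻¹ *ᵥ diagonal rl *ᵥ v = v := by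
    rw [inv_diagonal_of_pos hr]
    ext i
    simp [mulVec_diagonal, (hr i).ne']
  have h2 : ∀ c : Fin m → ℝ, (diagonal rl *ᵥ v) ⬝ᵥ (diagonal rl)⁻¹ *ᵥ c = v ⬝ᵥ c := by
    intro c
    rw [inv_diagonal_of_pos hr]
    simp only [dotProduct, mulVec_diagonal]
    refine Finset.sum_congr rfl fun i _ => ?_
    have := (hr i).ne'
    field_simp
  have h3 : (diagonal rl *ᵥ v) ⬝ᵥ diagonal kl *ᵥ v = ∑ i, kl i * rl i * v i ^ 2 := by
    simp only [dotProduct, mulVec_diagonal]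
    exact Finset.sum_congr rfl fun i _ => by ring
  have h4 : a ⬝ᵥ Υᵀ *ᵥ v = v ⬝ᵥ Υ *ᵥ a := by
    rw [dotProduct_mulVec, vecMul_transpose, dotProduct_comm]
  rw [Theta]
  simp only [fromBlocks_mulVec, fromRows_mulVec, fromCols_mulVec_sumElim, Sum.elim_comp_inl,
    Sum.elim_comp_inr, sumElim_dotProduct_sumElim, zero_mulVec, add_zero, zero_add, smul_mulVec,
    neg_mulVec, ← mulVec_mulVec, h1, dotProduct_add, ← Sum.elim_add_add, dotProduct_neg,
    dotProduct_smul, h2, h3, h4, smul_eq_mul, dotProduct_comm b v]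
  ring

/-- `Θ` is positive definite near a point if `K_ℓ R_ℓ` is large. -/
theorem eventually_posDef_Theta {E : Type*} [TopologicalSpace E] {Λl : E → Fin s → ℝ}
    {Λc : E → Fin m → ℝ} {x₀ : E} (hl : ContinuousAt Λl x₀) (hc : ContinuousAt Λc x₀)
    (hl0 : ∀ i, 0 < Λl x₀ i) (hc0 : ∀ i, 0 < Λc x₀ i) (Υ : Matrix (Fin m) (Fin s) ℝ) :
    ∃ c : ℝ, 0 < c ∧ ∀ kl rl : Fin m → ℝ, (∀ i, 0 < rl i) → (∀ i, c ≤ kl i * rl i) →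
      ∀ᶠ x in 𝓝 x₀, (Theta (Λl x) (Λc x) Υ kl rl).PosDef := by
  set δ : Fin s → ℝ := fun i => Λl x₀ i / (4 * (m + 1)) with hδ
  have hδ0 : ∀ i, 0 < δ i := fun i => div_pos (hl0 i) (by positivity)
  set c₁ : ℝ := ∑ j, ∑ i, Υ j i ^ 2 / (4 * δ i) with hc₁
  set c₂ : ℝ := ∑ j, 1 / Λc x₀ j with hc₂
  have hterm₁ : ∀ j i, 0 ≤ Υ j i ^ 2 / (4 * δ i) := fun j i =>
    div_nonneg (sq_nonneg _) (by linarith [hδ0 i])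
  have hterm₂ : ∀ j, 0 ≤ 1 / Λc x₀ j := fun j => div_nonneg zero_le_one (hc0 j).le
  have hc₁0 : 0 ≤ c₁ := Finset.sum_nonneg fun j _ => Finset.sum_nonneg fun i _ => hterm₁ j i
  have hc₂0 : 0 ≤ c₂ := Finset.sum_nonneg fun j _ => hterm₂ j
  refine ⟨1 + c₁ + c₂, by linarith, fun kl rl hr hkr => ?_⟩
  have hl' : ∀ᶠ x in 𝓝 x₀, ∀ i, Λl x₀ i / 2 < Λl x i := eventually_all.2 fun i =>
    continuousAt_const.eventually_lt (continuousAt_pi.1 hl i) (half_lt_self (hl0 i))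
  have hc' : ∀ᶠ x in 𝓝 x₀, ∀ i, Λc x₀ i / 2 < Λc x i := eventually_all.2 fun i =>
    continuousAt_const.eventually_lt (continuousAt_pi.1 hc i) (half_lt_self (hc0 i))
  filter_upwards [hl', hc'] with x hlx hcx
  refine PosDef.of_dotProduct_mulVec_pos (isHermitian_Theta _ _ _ _ hr) fun w hw => ?_
  obtain ⟨a, b, v, rfl⟩ : ∃ (a : Fin s → ℝ) (b v : Fin m → ℝ),
      w = Sum.elim (Sum.elim a b) (diagonal rl *ᵥ v) := by
    refine ⟨fun i => w (.inl (.inl i)), fun i => w (.inl (.inr i)),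
      fun i => w (.inr i) / rl i, ?_⟩
    ext ((i | i) | i)
    · rfl
    · rfl
    · have := (hr i).ne'
      simp only [Sum.elim_inr, mulVec_diagonal]
      field_simp
  rw [star_trivial, dotProduct_Theta_mulVec _ _ _ _ hr, dotProduct_diagonal_mulVec_self,
    dotProduct_diagonal_mulVec_self]
  have e₁ : -(∑ i, Λl x₀ i / 4 * a i ^ 2) - c₁ * ∑ j, v j ^ 2 ≤ v ⬝ᵥ Υ *ᵥ a := by
    have hji : ∀ j i, -(δ i * a i ^ 2 + Υ j i ^ 2 / (4 * δ i) * v j ^ 2)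
        ≤ v j * (Υ j i * a i) := by
      intro j i
      have h0 := hδ0 i
      have : δ i * a i ^ 2 + Υ j i ^ 2 / (4 * δ i) * v j ^ 2 + v j * (Υ j i * a i)
          = δ i * (a i + Υ j i * v j / (2 * δ i)) ^ 2 := by
        field_simp
        ring
      have := mul_nonneg h0.le (sq_nonneg (a i + Υ j i * v j / (2 * δ i)))
      linarith
    have hsum : ∑ j, ∑ i, -(δ i * a i ^ 2 + Υ j i ^ 2 / (4 * δ i) * v j ^ 2)
        ≤ v ⬝ᵥ Υ *ᵥ a := by
      simp only [dotProduct, mulVec, Finset.mul_sum]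
      exact Finset.sum_le_sum fun j _ => Finset.sum_le_sum fun i _ => hji j i
    refine le_trans ?_ hsum
    simp only [Finset.sum_neg_distrib, Finset.sum_add_distrib, Finset.sum_const,
      Finset.card_univ, Fintype.card_fin, nsmul_eq_mul]
    have h5 : (m : ℝ) * ∑ i, δ i * a i ^ 2 ≤ ∑ i, Λl x₀ i / 4 * a i ^ 2 := by
      rw [Finset.mul_sum]
      refine Finset.sum_le_sum fun i _ => ?_
      rw [← mul_assoc]
      refine mul_le_mul_of_nonneg_right ?_ (sq_nonneg _)
      rw [hδ, ← mul_div_assoc, div_le_div_iff₀ (by positivity) (by norm_num)]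
      nlinarith [hl0 i]
    have h6 : ∑ j, ∑ i, Υ j i ^ 2 / (4 * δ i) * v j ^ 2 ≤ c₁ * ∑ j, v j ^ 2 := by
      rw [Finset.mul_sum]
      refine Finset.sum_le_sum fun j _ => ?_
      rw [← Finset.sum_mul]
      exact mul_le_mul_of_nonneg_right (Finset.single_le_sum (f := fun j =>
        ∑ i, Υ j i ^ 2 / (4 * δ i)) (fun j _ => Finset.sum_nonneg fun i _ => hterm₁ j i)
        (Finset.mem_univ j)) (sq_nonneg _)
    linarith
  have e₂ : v ⬝ᵥ b ≤ ∑ j, Λc x₀ j / 4 * b j ^ 2 + c₂ * ∑ j, v j ^ 2 := by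
    rw [Finset.mul_sum, ← Finset.sum_add_distrib]
    refine Finset.sum_le_sum fun j _ => ?_
    have h0 := hc0 j
    have h7 : 1 / Λc x₀ j * v j ^ 2 ≤ c₂ * v j ^ 2 :=
      mul_le_mul_of_nonneg_right (Finset.single_le_sum (f := fun j => 1 / Λc x₀ j)
        (fun j _ => hterm₂ j) (Finset.mem_univ j)) (sq_nonneg _)
    have h8 : Λc x₀ j / 4 * b j ^ 2 + 1 / Λc x₀ j * v j ^ 2 - v j * b j
        = Λc x₀ j / 4 * (b j - 2 * v j / Λc x₀ j) ^ 2 := by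
      field_simp
      ring
    have h9 : 0 ≤ Λc x₀ j / 4 * (b j - 2 * v j / Λc x₀ j) ^ 2 :=
      mul_nonneg (by linarith) (sq_nonneg _)
    linarith
  have e₃ : (1 + c₁ + c₂) * ∑ j, v j ^ 2 ≤ ∑ j, kl j * rl j * v j ^ 2 := by
    rw [Finset.mul_sum]
    exact Finset.sum_le_sum fun j _ => mul_le_mul_of_nonneg_right (hkr j) (sq_nonneg _)
  have e₄ : ∑ i, Λl x₀ i / 2 * a i ^ 2 ≤ ∑ i, Λl x i * a i ^ 2 :=
    Finset.sum_le_sum fun i _ => mul_le_mul_of_nonneg_right (hlx i).le (sq_nonneg _)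
  have e₅ : ∑ i, Λc x₀ i / 2 * b i ^ 2 ≤ ∑ i, Λc x i * b i ^ 2 :=
    Finset.sum_le_sum fun i _ => mul_le_mul_of_nonneg_right (hcx i).le (sq_nonneg _)
  have e₆ : ∑ i, Λl x₀ i / 2 * a i ^ 2 = 2 * ∑ i, Λl x₀ i / 4 * a i ^ 2 := by
    rw [Finset.mul_sum]; exact Finset.sum_congr rfl fun i _ => by ring
  have e₇ : ∑ i, Λc x₀ i / 2 * b i ^ 2 = 2 * ∑ i, Λc x₀ i / 4 * b i ^ 2 := by
    rw [Finset.mul_sum]; exact Finset.sum_congr rfl fun i _ => by ring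
  have p₁ : ∀ i, 0 ≤ Λl x₀ i / 4 * a i ^ 2 := fun i => by have := hl0 i; positivity
  have p₂ : ∀ i, 0 ≤ Λc x₀ i / 4 * b i ^ 2 := fun i => by have := hc0 i; positivity
  have p₃ : ∀ i, 0 ≤ v i ^ 2 := fun i => sq_nonneg _
  have hpos : 0 < ∑ i, Λl x₀ i / 4 * a i ^ 2 + ∑ i, Λc x₀ i / 4 * b i ^ 2 + ∑ j, v j ^ 2 := by
    have q₁ := Finset.sum_nonneg fun i (_ : i ∈ Finset.univ) => p₁ i
    have q₂ := Finset.sum_nonneg fun i (_ : i ∈ Finset.univ) => p₂ i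
    have q₃ := Finset.sum_nonneg fun i (_ : i ∈ Finset.univ) => p₃ i
    refine lt_of_le_of_ne (by linarith) fun h0 => hw ?_
    have z₁ := (Finset.sum_eq_zero_iff_of_nonneg fun i _ => p₁ i).1
      (show ∑ i, Λl x₀ i / 4 * a i ^ 2 = 0 by linarith)
    have z₂ := (Finset.sum_eq_zero_iff_of_nonneg fun i _ => p₂ i).1
      (show ∑ i, Λc x₀ i / 4 * b i ^ 2 = 0 by linarith)
    have z₃ := (Finset.sum_eq_zero_iff_of_nonneg fun i _ => p₃ i).1
      (show ∑ i, v i ^ 2 = 0 by linarith)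
    ext ((i | i) | i)
    · simpa [(hl0 i).ne'] using z₁ i (Finset.mem_univ i)
    · simpa [(hc0 i).ne'] using z₂ i (Finset.mem_univ i)
    · have : v i = 0 := by simpa using z₃ i (Finset.mem_univ i)
      simp [mulVec_diagonal, this]
  linarith

/-- Completing the square: if `H > 0` and `K ≥ 1 + Bᵀ H⁻¹ B` then
`dᵀ H d + 2 dᵀ B e + eᵀ K e > 0` away from zero. -/
theorem quadratic_pos_of_schur {H : Matrix (Fin n) (Fin n) ℝ} (hH : H.PosDef)
    (B : Matrix (Fin n) (Fin m) ℝ) {K : Matrix (Fin m) (Fin m) ℝ}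
    (hK : (K - (1 + Bᵀ * H⁻¹ * B)).PosSemidef) {d : Fin n → ℝ} {e : Fin m → ℝ}
    (hde : d ≠ 0 ∨ e ≠ 0) : 0 < d ⬝ᵥ H *ᵥ d + 2 * (d ⬝ᵥ B *ᵥ e) + e ⬝ᵥ K *ᵥ e := by
  have hHt : Hᵀ = H := by simpa using hH.isHermitian.eq
  have hinv : H *ᵥ H⁻¹ *ᵥ B *ᵥ e = B *ᵥ e := by
    rw [mulVec_mulVec, mul_nonsing_inv H ((isUnit_iff_isUnit_det H).1 hH.isUnit), one_mulVec]
  have hsymm : ∀ u v : Fin n → ℝ, u ⬝ᵥ H *ᵥ v = v ⬝ᵥ H *ᵥ u := by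
    intro u v
    rw [dotProduct_mulVec, ← mulVec_transpose, hHt, dotProduct_comm]
  have h1 := hK.dotProduct_mulVec_nonneg e
  have hB : e ⬝ᵥ Bᵀ *ᵥ H⁻¹ *ᵥ B *ᵥ e = (H⁻¹ *ᵥ B *ᵥ e) ⬝ᵥ B *ᵥ e := by
    rw [dotProduct_mulVec, vecMul_transpose, dotProduct_comm]
  simp only [star_trivial, sub_mulVec, add_mulVec, one_mulVec, dotProduct_sub, dotProduct_add,
    ← mulVec_mulVec, hB] at h1
  set b := H⁻¹ *ᵥ B *ᵥ e with hb
  have h2 : (d + b) ⬝ᵥ H *ᵥ (d + b) = d ⬝ᵥ H *ᵥ d + 2 * (d ⬝ᵥ B *ᵥ e) + b ⬝ᵥ B *ᵥ e := by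
    rw [mulVec_add, dotProduct_add, add_dotProduct, add_dotProduct, hsymm b d, hinv]
    ring
  have h3 : 0 ≤ (d + b) ⬝ᵥ H *ᵥ (d + b) := hH.posSemidef.dotProduct_mulVec_nonneg (d + b)
  have h4 : 0 ≤ e ⬝ᵥ e := Finset.sum_nonneg fun i _ => mul_self_nonneg _
  by_cases he : e = 0
  · have hd : d ≠ 0 := hde.resolve_right (not_not.2 he)
    have h5 : 0 < d ⬝ᵥ H *ᵥ d := hH.dotProduct_mulVec_pos hd
    simpa [he] using h5
  · have h5 : 0 < e ⬝ᵥ e := lt_of_le_of_ne h4 fun h => he (dotProduct_self_eq_zero.1 h.symm)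
    linarith

end Matrices

end SatControl

namespace SatControl

section ClosedLoopAnalysis

variable {n m r s : ℕ} {P : Plant n m} {S : (Fin n → ℝ) → ℝ} {l : (Fin n → ℝ) → Fin r → ℝ}
  {w : (Fin n → ℝ) → Matrix (Fin r) (Fin m) ℝ} {D : (Fin n → ℝ) → Matrix (Fin m) (Fin m) ℝ}
  {γ : (Fin n → ℝ) → Fin m → ℝ} {η : (Fin n → ℝ) → Fin s → ℝ} {xs : Fin n → ℝ}
  {α β : Fin m → ℝ} {Λl : (Fin n → ℝ) → Fin s → ℝ} {Λc : (Fin n → ℝ) → Fin m → ℝ}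
  {G : Gains m s}

theorem fderiv_apply_eq_of_hasDerivAt {E : Type*} [NormedAddCommGroup E] [NormedSpace ℝ E]
    {f : E → ℝ} {q v : E} {d : ℝ} (hf : DifferentiableAt ℝ f q)
    (h : HasDerivAt (fun t : ℝ => f (q + t • v)) d 0) : fderiv ℝ f q v = d := by
  have h1 : HasDerivAt (fun t : ℝ => q + t • v) v 0 := by
    simpa using ((hasDerivAt_id (0 : ℝ)).smul_const v).const_add q
  have h2 : HasFDerivAt f (fderiv ℝ f q) (q + (0 : ℝ) • v) := by
    simpa using hf.hasFDerivAt
  exact (h2.comp_hasDerivAt 0 h1).unique h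

theorem hasDerivAt_fderiv_line {E : Type*} [NormedAddCommGroup E] [NormedSpace ℝ E]
    {f : E → ℝ} {q : E} (hf : ContDiffAt ℝ 2 f q) (v : E) :
    HasDerivAt (fun t : ℝ => fderiv ℝ f (q + t • v) v) (fderiv ℝ (fderiv ℝ f) q v v) 0 := by
  have h1 : HasDerivAt (fun t : ℝ => q + t • v) v 0 := by
    simpa using ((hasDerivAt_id (0 : ℝ)).smul_const v).const_add q
  have h2 : HasFDerivAt (fderiv ℝ f) (fderiv ℝ (fderiv ℝ f) q) (q + (0 : ℝ) • v) := by
    rw [zero_smul, add_zero]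
    exact ((hf.fderiv_right (m := 1) (by norm_num)).differentiableAt one_ne_zero).hasFDerivAt
  have h3 : HasDerivAt (fun t : ℝ => fderiv ℝ f (q + t • v)) (fderiv ℝ (fderiv ℝ f) q v) 0 :=
    h2.comp_hasDerivAt 0 h1
  exact (h3.clm_apply (hasDerivAt_const (0 : ℝ) v)).congr_deriv (by simp)

theorem contDiff_mulVec {k : WithTop ℕ∞} {a b : ℕ} (A : Matrix (Fin a) (Fin b) ℝ) :
    ContDiff ℝ k fun v : Fin b → ℝ => A *ᵥ v :=
  (Matrix.mulVecLin A).toContinuousLinearMap.contDiff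

theorem contDiffOn_dotProduct {E : Type*} [NormedAddCommGroup E] [NormedSpace ℝ E]
    {k : WithTop ℕ∞} {a : ℕ} {Y : Set E} {f g : E → Fin a → ℝ} (hf : ContDiffOn ℝ k f Y)
    (hg : ContDiffOn ℝ k g Y) : ContDiffOn ℝ k (fun x => f x ⬝ᵥ g x) Y :=
  ContDiffOn.sum fun i _ => (contDiffOn_pi.1 hf i).mul (contDiffOn_pi.1 hg i)

theorem control_eq (hl : ∀ i, 0 < G.βl i) (hc : ∀ i, 0 < G.βc i) (q : State n m) :
    control P γ η xs G q =
      -P.kappa xs - sat G.αl G.βl (zl η xs G q) - sat G.αc G.βc (zc γ xs q) := by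
  rw [control, grad_logCosh hl, grad_logCosh hc]

theorem zl_self : zl η xs G ((xs, 0, 0) : State n m) = 0 := by
  simp [zl]

theorem zc_self : zc γ xs ((xs, 0, 0) : State n m) = 0 := by
  simp [zc]

theorem isOpen_stateSpace : IsOpen (stateSpace P) :=
  P.isOpen_X.preimage continuous_fst

theorem Gains.Admissible.βc_pos (hG : G.Admissible α β) (hβ : ∀ i, 0 < β i) (i : Fin m) :
    0 < G.βc i := hG.βc_eq ▸ hβ i

theorem Gains.Admissible.αc_pos (hG : G.Admissible α β) (hα : ∀ i, 0 < α i) (i : Fin m) :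
    0 < G.αc i := hG.αc_eq ▸ hα i

section Smoothness

theorem contDiffOn_zc {k : WithTop ℕ∞} (hγ : ContDiffOn ℝ k γ P.X) :
    ContDiffOn ℝ k (zc γ xs) (stateSpace P) :=
  ((hγ.comp contDiff_fst.contDiffOn fun _ hq => hq).sub contDiffOn_const).add
    (contDiff_snd.comp contDiff_snd).contDiffOn

theorem contDiffOn_zl {k : WithTop ℕ∞} (hη : ContDiffOn ℝ k η P.X) :
    ContDiffOn ℝ k (zl η xs G) (stateSpace P) :=
  ((contDiff_mulVec G.Υ).comp_contDiffOn
    ((hη.comp contDiff_fst.contDiffOn fun _ hq => hq).sub contDiffOn_const)).add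
    ((contDiff_mulVec (diagonal G.kl)).comp (contDiff_fst.comp contDiff_snd)).contDiffOn

theorem contDiffOn_Sdc {k : WithTop ℕ∞} (hS : ContDiffOn ℝ k S P.X) (hγ : ContDiffOn ℝ k γ P.X) :
    ContDiffOn ℝ k (Sdc P S γ xs G) (stateSpace P) := by
  have hfst : ContDiffOn ℝ k (fun q : State n m => q.1) (stateSpace P) := contDiff_fst.contDiffOn
  have hξ : ContDiffOn ℝ k (fun q : State n m => q.2.2) (stateSpace P) :=
    (contDiff_snd.comp contDiff_snd).contDiffOn
  exact (((hS.comp hfst fun _ hq => hq).add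
    ((contDiff_logCosh _ _).comp_contDiffOn (contDiffOn_zc hγ))).add
    (contDiffOn_dotProduct contDiffOn_const (hγ.comp hfst fun _ hq => hq))).add
    (contDiffOn_const.mul (contDiffOn_dotProduct hξ ((contDiff_mulVec G.Kc).comp_contDiffOn hξ)))

theorem contDiffOn_Sdl {k : WithTop ℕ∞} (hS : ContDiffOn ℝ k S P.X) (hγ : ContDiffOn ℝ k γ P.X)
    (hη : ContDiffOn ℝ k η P.X) : ContDiffOn ℝ k (Sdl P S γ η xs G) (stateSpace P) :=
  (contDiffOn_Sdc hS hγ).add ((contDiff_logCosh _ _).comp_contDiffOn (contDiffOn_zl hη))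

theorem contDiffOn_closedLoop (hl : ∀ i, 0 < G.βl i) (hc : ∀ i, 0 < G.βc i)
    (hγ : ContDiffOn ℝ 1 γ P.X) (hη : ContDiffOn ℝ 1 η P.X) :
    ContDiffOn ℝ 1 (closedLoop P γ η xs G) (stateSpace P) := by
  have hfst : ContDiffOn ℝ 1 (fun q : State n m => q.1) (stateSpace P) := contDiff_fst.contDiffOn
  have hξ : ContDiffOn ℝ 1 (fun q : State n m => q.2.2) (stateSpace P) :=
    (contDiff_snd.comp contDiff_snd).contDiffOn
  have hσl : ContDiffOn ℝ 1 (fun q : State n m => sat G.αl G.βl (zl η xs G q)) (stateSpace P) :=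
    (contDiff_sat _ _).comp_contDiffOn (contDiffOn_zl hη)
  have hσc : ContDiffOn ℝ 1 (fun q : State n m => sat G.αc G.βc (zc γ xs q)) (stateSpace P) :=
    (contDiff_sat _ _).comp_contDiffOn (contDiffOn_zc hγ)
  have hu : ContDiffOn ℝ 1 (control P γ η xs G) (stateSpace P) := by
    rw [show control P γ η xs G = fun q => _ from funext fun q => control_eq hl hc q]
    exact (contDiffOn_const.sub hσl).sub hσc
  refine ContDiffOn.prodMk ?_ (ContDiffOn.prodMk ?_ ?_)
  · refine (P.contDiffOn_f.comp hfst fun _ hq => hq).add (contDiffOn_pi.2 fun i => ?_)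
    exact contDiffOn_dotProduct
      (contDiffOn_pi.2 fun j => (P.contDiffOn_g i j).comp hfst fun _ hq => hq) hu
  · exact ((contDiff_mulVec (diagonal G.rl)).comp_contDiffOn hσl).neg
  · exact ((contDiff_mulVec G.Rc).comp_contDiffOn
      (hσc.add ((contDiff_mulVec G.Kc).comp_contDiffOn hξ))).neg

end Smoothness

/-- The control `-κ` keeps an assignable equilibrium at rest. -/
theorem Plant.velocity_neg_kappa (hxs : xs ∈ P.assignable) :
    P.velocity xs (-P.kappa xs) = 0 := by
  obtain ⟨hX, hann⟩ := hxs
  set g := P.g xs with hg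
  have hdet : IsUnit (gᵀ * g).det := by
    rw [← isUnit_iff_isUnit_det, ← mulVec_surjective_iff_isUnit]
    have hrange : LinearMap.range (gᵀ * g).mulVecLin = ⊤ := by
      refine Submodule.eq_top_of_finrank_eq ?_
      change (gᵀ * g).rank = _
      rw [rank_transpose_mul_self, hg, P.rank_g xs hX, Module.finrank_fin_fun]
    exact LinearMap.range_eq_top.1 hrange
  have h1 : P.velocity xs (-P.kappa xs) ᵥ* g = 0 := by
    rw [← mulVec_transpose, Plant.velocity, mulVec_add, Plant.kappa, ← hg, mulVec_neg, mulVec_neg,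
      mulVec_mulVec, mulVec_mulVec, ← Matrix.mul_assoc,
      mul_nonsing_inv _ hdet, Matrix.one_mul, add_neg_cancel]
  have h2 := hann _ h1
  have h3 : P.velocity xs (-P.kappa xs) ⬝ᵥ P.velocity xs (-P.kappa xs) = 0 := by
    conv_lhs => enter [2]; rw [Plant.velocity]
    rw [dotProduct_add, h2, dotProduct_mulVec, ← hg, h1]
    simp
  exact dotProduct_self_eq_zero.1 h3

theorem closedLoop_self (hl : ∀ i, 0 < G.βl i) (hc : ∀ i, 0 < G.βc i)
    (hxs : xs ∈ P.assignable) : closedLoop P γ η xs G (xs, 0, 0) = 0 := by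
  simp [closedLoop, control_eq hl hc, zl_self, zc_self, xlDot, xcDot,
    Plant.velocity_neg_kappa hxs]

/-- The power balance `∇S · x' = u · y - ‖ℓ + w u‖²`. -/
theorem grad_dotProduct_velocity (h1 : P.Assumption1 S l) {x : Fin n → ℝ} (hx : x ∈ P.X)
    (hD : (D x)ᵀ = -D x) (u : Fin m → ℝ) :
    grad S x ⬝ᵥ P.velocity x u =
      u ⬝ᵥ P.output S l w D x u - (l x + w x *ᵥ u) ⬝ᵥ (l x + w x *ᵥ u) := by
  have hDu : u ⬝ᵥ D x *ᵥ u = 0 := by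
    have h : u ⬝ᵥ D x *ᵥ u = -(u ⬝ᵥ D x *ᵥ u) := by
      conv_lhs => rw [dotProduct_mulVec, ← mulVec_transpose, hD, neg_mulVec, neg_dotProduct,
        dotProduct_comm]
    linarith
  have hg : u ⬝ᵥ (P.g x)ᵀ *ᵥ grad S x = grad S x ⬝ᵥ P.g x *ᵥ u := by
    rw [dotProduct_mulVec, vecMul_transpose, dotProduct_comm]
  have hw : ∀ v, u ⬝ᵥ (w x)ᵀ *ᵥ v = v ⬝ᵥ w x *ᵥ u := fun v => by
    rw [dotProduct_mulVec, vecMul_transpose, dotProduct_comm]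
  rw [Plant.velocity, Plant.output, dotProduct_add, h1.dissipation x hx]
  simp only [dotProduct_add, add_dotProduct, dotProduct_smul, add_mulVec, ← mulVec_mulVec, hg,
    hw, hDu, smul_eq_mul, dotProduct_comm (w x *ᵥ u) (l x)]
  ring

theorem hasDerivAt_Sdc (hc : ∀ i, 0 < G.βc i) (hK : G.Kcᵀ = G.Kc) {x : ℝ → Fin n → ℝ}
    {y z : ℝ → Fin m → ℝ} {x' : Fin n → ℝ} {z' : Fin m → ℝ} {t : ℝ} (hx : HasDerivAt x x' t)
    (hz : HasDerivAt z z' t) (hS : DifferentiableAt ℝ S (x t))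
    (hγ : DifferentiableAt ℝ γ (x t)) :
    HasDerivAt (fun t => Sdc P S γ xs G (x t, y t, z t))
      (grad S (x t) ⬝ᵥ x' + sat G.αc G.βc (zc γ xs (x t, y t, z t)) ⬝ᵥ ((jac γ (x t))ᵀ *ᵥ x' + z')
        + P.kappa xs ⬝ᵥ (jac γ (x t))ᵀ *ᵥ x' + z' ⬝ᵥ G.Kc *ᵥ z t) t := by
  have hγ' := hasDerivAt_comp_jac hγ hx
  have hzc : HasDerivAt (fun t => zc γ xs (x t, y t, z t)) ((jac γ (x t))ᵀ *ᵥ x' + z') t :=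
    (hγ'.sub_const (γ xs)).add hz
  have hsymm : z t ⬝ᵥ G.Kc *ᵥ z' = z' ⬝ᵥ G.Kc *ᵥ z t := by
    rw [dotProduct_mulVec, ← mulVec_transpose, hK, dotProduct_comm]
  refine ((((hasDerivAt_comp_grad hS hx).add (hasDerivAt_logCosh hc hzc)).add
    (hasDerivAt_dotProduct (hasDerivAt_const t (P.kappa xs)) hγ')).add
    ((hasDerivAt_dotProduct hz (hasDerivAt_mulVec G.Kc hz)).const_mul (1 / 2))).congr_deriv ?_
  rw [hsymm, zero_dotProduct]
  ring

theorem fderiv_Sdl (hl : ∀ i, 0 < G.βl i) (hc : ∀ i, 0 < G.βc i) (hK : G.Kcᵀ = G.Kc)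
    (hS : ContDiffOn ℝ 1 S P.X) (hγ : ContDiffOn ℝ 1 γ P.X) (hη : ContDiffOn ℝ 1 η P.X)
    {q : State n m} (hq : q ∈ stateSpace P) (v : State n m) :
    fderiv ℝ (Sdl P S γ η xs G) q v =
      grad S q.1 ⬝ᵥ v.1 + sat G.αc G.βc (zc γ xs q) ⬝ᵥ ((jac γ q.1)ᵀ *ᵥ v.1 + v.2.2)
        + P.kappa xs ⬝ᵥ (jac γ q.1)ᵀ *ᵥ v.1 + v.2.2 ⬝ᵥ G.Kc *ᵥ q.2.2
        + sat G.αl G.βl (zl η xs G q) ⬝ᵥ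
          (G.Υ *ᵥ (jac η q.1)ᵀ *ᵥ v.1 + diagonal G.kl *ᵥ v.2.1) := by
  have hnhds := isOpen_stateSpace.mem_nhds hq
  refine fderiv_apply_eq_of_hasDerivAt
    (((contDiffOn_Sdl hS hγ hη).contDiffAt hnhds).differentiableAt one_ne_zero) ?_
  have hX := P.isOpen_X.mem_nhds hq
  have line : ∀ {a : ℕ} (u v : Fin a → ℝ), HasDerivAt (fun t : ℝ => u + t • v) v 0 :=
    fun u v => by simpa using ((hasDerivAt_id (0 : ℝ)).smul_const v).const_add u
  have hz : q.1 + (0 : ℝ) • v.1 = q.1 := by simp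
  have hη' : DifferentiableAt ℝ η (q.1 + (0 : ℝ) • v.1) := by
    rw [hz]; exact (hη.contDiffAt hX).differentiableAt one_ne_zero
  have h1 := hasDerivAt_Sdc (P := P) (xs := xs) (y := fun t : ℝ => q.2.1 + t • v.2.1) hc hK
    (line q.1 v.1) (line q.2.2 v.2.2) (S := S) (γ := γ)
    (by rw [hz]; exact (hS.contDiffAt hX).differentiableAt one_ne_zero)
    (by rw [hz]; exact (hγ.contDiffAt hX).differentiableAt one_ne_zero)
  have h2 : HasDerivAt (fun t : ℝ => zl η xs G (q + t • v))
      (G.Υ *ᵥ (jac η (q.1 + (0 : ℝ) • v.1))ᵀ *ᵥ v.1 + diagonal G.kl *ᵥ v.2.1) 0 :=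
    (hasDerivAt_mulVec G.Υ ((hasDerivAt_comp_jac hη' (line q.1 v.1)).sub_const (η xs))).add
      (hasDerivAt_mulVec (diagonal G.kl) (line q.2.1 v.2.1))
  exact (h1.add (hasDerivAt_logCosh (a := G.αl) hl h2)).congr_deriv (by simp)

/-- The dissipation inequality for the closed loop. -/
theorem fderiv_Sdl_closedLoop_le (h1 : P.Assumption1 S l) (h2 : P.Assumption2 S l w D γ α β xs)
    (h3 : P.Assumption3 S l w D γ η Λl Λc) (hG : G.Admissible α β) {q : State n m}
    (hq : q ∈ stateSpace P) :
    fderiv ℝ (Sdl P S γ η xs G) q (closedLoop P γ η xs G q) ≤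
      -(Sum.elim (Sum.elim (P.rate η q.1 (control P γ η xs G q))
            (P.output S l w D q.1 (control P γ η xs G q))) (xlDot η xs G q) ⬝ᵥ
          Theta (Λl q.1) (Λc q.1) G.Υ G.kl G.rl *ᵥ
            Sum.elim (Sum.elim (P.rate η q.1 (control P γ η xs G q))
              (P.output S l w D q.1 (control P γ η xs G q))) (xlDot η xs G q))
        - (sat G.αc G.βc (zc γ xs q) + G.Kc *ᵥ q.2.2) ⬝ᵥ
            G.Rc *ᵥ (sat G.αc G.βc (zc γ xs q) + G.Kc *ᵥ q.2.2) := by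
  have hc := hG.βc_pos h2.β_pos
  have hK : G.Kcᵀ = G.Kc := by simpa using hG.Kc_posDef.isHermitian.eq
  rw [fderiv_Sdl hG.βl_pos hc hK (h1.contDiffOn_S.of_le one_le_two)
    (h2.contDiffOn_γ.of_le one_le_two) h3.contDiffOn_η hq]
  set u := control P γ η xs G q with hu
  have hy : (jac γ q.1)ᵀ *ᵥ P.velocity q.1 u = P.output S l w D q.1 u := h2.rate_γ q.1 hq u
  have hη' : (jac η q.1)ᵀ *ᵥ P.velocity q.1 u = P.rate η q.1 u := rfl
  have hxl : xlDot η xs G q = diagonal G.rl *ᵥ (-sat G.αl G.βl (zl η xs G q)) := by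
    rw [mulVec_neg]; rfl
  have hbal := grad_dotProduct_velocity (w := w) h1 hq (h2.skew q.1 hq) u
  have hdamp := h3.damping q.1 hq u
  generalize (l q.1 + w q.1 *ᵥ u) ⬝ᵥ (l q.1 + w q.1 *ᵥ u) = δ at hbal hdamp
  simp only [closedLoop, ← hu, hy, hη', hbal]
  rw [hxl, dotProduct_Theta_mulVec _ _ _ _ hG.rl_pos]
  set y := P.output S l w D q.1 u
  set σl := sat G.αl G.βl (zl η xs G q) with hσl
  set σc := sat G.αc G.βc (zc γ xs q) with hσc
  have huy : u ⬝ᵥ y = -(P.kappa xs ⬝ᵥ y) - σl ⬝ᵥ y - σc ⬝ᵥ y := by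
    rw [hu, control_eq hG.βl_pos hc, sub_dotProduct, sub_dotProduct, neg_dotProduct]
  have hxc : σc ⬝ᵥ xcDot γ xs G q + xcDot γ xs G q ⬝ᵥ G.Kc *ᵥ q.2.2
      = -((σc + G.Kc *ᵥ q.2.2) ⬝ᵥ G.Rc *ᵥ (σc + G.Kc *ᵥ q.2.2)) := by
    rw [dotProduct_comm (xcDot γ xs G q), ← add_dotProduct, ← dotProduct_neg]
    rfl
  have hkr : σl ⬝ᵥ diagonal G.kl *ᵥ diagonal G.rl *ᵥ (-σl)
      = -∑ i, G.kl i * G.rl i * (-σl) i ^ 2 := by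
    simp only [dotProduct, mulVec_diagonal, ← Finset.sum_neg_distrib, Pi.neg_apply]
    exact Finset.sum_congr rfl fun i _ => by ring
  simp only [dotProduct_add, neg_dotProduct, hkr, huy]
  linarith

/-- The shaped storage, as a function of the plant state and `x_c`, has a strict minimum. -/
theorem eventually_Sdc_lt (h1 : P.Assumption1 S l) (h2 : P.Assumption2 S l w D γ α β xs)
    (hG : G.Admissible α β)
    (hK₀ : (G.Kc - (1 + (jac γ xs * diagonal (α * β))ᵀ * (hess S xs
      + ∑ i, (α i * β i) • vecMulVec (grad (fun x => γ x i) xs) (grad (fun x => γ x i) xs)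
      + hess (fun x => γ x ⬝ᵥ P.kappa xs) xs)⁻¹ * (jac γ xs * diagonal (α * β)))).PosSemidef) :
    ∀ᶠ p : (Fin n → ℝ) × (Fin m → ℝ) in 𝓝 (xs, 0), p ≠ (xs, 0) →
      Sdc P S γ xs G (xs, 0, 0) < Sdc P S γ xs G (p.1, 0, p.2) := by
  have hc := hG.βc_pos h2.β_pos
  have hK : G.Kcᵀ = G.Kc := by simpa using hG.Kc_posDef.isHermitian.eq
  have hxs : xs ∈ P.X := h2.assignable.1
  set h : (Fin n → ℝ) → ℝ := fun x => γ x ⬝ᵥ P.kappa xs with hh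
  have hS2 := h1.contDiffOn_S
  have hγ2 := h2.contDiffOn_γ
  have hdS : ∀ x ∈ P.X, DifferentiableAt ℝ S x := fun x hx =>
    (hS2.contDiffAt (P.isOpen_X.mem_nhds hx)).differentiableAt two_ne_zero
  have hdγ : ∀ x ∈ P.X, DifferentiableAt ℝ γ x := fun x hx =>
    (hγ2.contDiffAt (P.isOpen_X.mem_nhds hx)).differentiableAt two_ne_zero
  have hh2 : ContDiffOn ℝ 2 h P.X := contDiffOn_dotProduct hγ2 contDiffOn_const
  have line : ∀ {a : ℕ} (u v : Fin a → ℝ) (t : ℝ), HasDerivAt (fun t : ℝ => u + t • v) v t :=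
    fun u v t => by simpa using ((hasDerivAt_id t).smul_const v).const_add u
  let W : (Fin n → ℝ) × (Fin m → ℝ) → ℝ := fun p => Sdc P S γ xs G (p.1, 0, p.2)
  have hW : ∀ p : (Fin n → ℝ) × (Fin m → ℝ), p.1 ∈ P.X → ContDiffAt ℝ 2 W p := by
    intro p hp
    refine ContDiffAt.comp p (g := Sdc P S γ xs G) (f := fun p => (p.1, 0, p.2))
      ((contDiffOn_Sdc hS2 hγ2).contDiffAt (isOpen_stateSpace.mem_nhds
        (show (p.1, 0, p.2) ∈ stateSpace P from hp))) ?_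
    exact (contDiff_fst.prodMk (contDiff_const.prodMk contDiff_snd)).contDiffAt
  have hdW : ∀ p : (Fin n → ℝ) × (Fin m → ℝ), p.1 ∈ P.X → ∀ v, fderiv ℝ W p v =
      grad S p.1 ⬝ᵥ v.1 + sat G.αc G.βc (γ p.1 - γ xs + p.2) ⬝ᵥ ((jac γ p.1)ᵀ *ᵥ v.1 + v.2)
        + grad h p.1 ⬝ᵥ v.1 + v.2 ⬝ᵥ G.Kc *ᵥ p.2 := by
    intro p hp v
    refine fderiv_apply_eq_of_hasDerivAt ((hW p hp).differentiableAt two_ne_zero) ?_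
    have hz : p.1 + (0 : ℝ) • v.1 = p.1 := by simp
    have h4 := hasDerivAt_Sdc (P := P) (xs := xs) (y := fun _ => 0) hc hK
      (line p.1 v.1 0) (line p.2 v.2 0) (S := S) (γ := γ) (by rw [hz]; exact hdS _ hp)
      (by rw [hz]; exact hdγ _ hp)
    refine h4.congr_deriv ?_
    have hgh : P.kappa xs ⬝ᵥ (jac γ p.1)ᵀ *ᵥ v.1 = grad h p.1 ⬝ᵥ v.1 := by
      rw [hh, grad_dotProduct_const (hdγ _ hp), dotProduct_mulVec, vecMul_transpose]
    simp [hgh, zc]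
  refine eventually_lt_of_fderiv_fderiv_pos (W := W) (hW (xs, 0) hxs) ?_ fun v hv => ?_
  · refine ContinuousLinearMap.ext fun v => ?_
    rw [hdW (xs, 0) hxs, hh, grad_dotProduct_const (hdγ _ hxs)]
    simp only [sub_self, add_zero, sat_zero, zero_dotProduct, mulVec_zero, dotProduct_zero,
      ← add_dotProduct, h2.critical, _root_.zero_apply]
  · obtain ⟨d, e⟩ := v
    have h4 : HasDerivAt (fun t : ℝ => fderiv ℝ W ((xs, 0) + t • (d, e)) (d, e))
        (fderiv ℝ (fderiv ℝ W) (xs, 0) (d, e) (d, e)) 0 :=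
      hasDerivAt_fderiv_line (hW (xs, 0) hxs) (d, e)
    have hev : (fun t : ℝ => fderiv ℝ W ((xs, 0) + t • (d, e)) (d, e)) =ᶠ[𝓝 0] fun t : ℝ =>
        grad S (xs + t • d) ⬝ᵥ d
          + sat G.αc G.βc (γ (xs + t • d) - γ xs + (0 + t • e)) ⬝ᵥ
            ((jac γ (xs + t • d))ᵀ *ᵥ d + e)
          + grad h (xs + t • d) ⬝ᵥ d + e ⬝ᵥ G.Kc *ᵥ (0 + t • e) := by
      have hcont : ContinuousAt (fun t : ℝ => xs + t • d) 0 := (line xs d 0).continuousAt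
      have hmem : ∀ᶠ t : ℝ in 𝓝 0, xs + t • d ∈ P.X :=
        hcont.eventually_mem (by simpa using P.isOpen_X.mem_nhds hxs)
      filter_upwards [hmem] with t ht
      exact hdW _ ht _
    have hz : xs + (0 : ℝ) • d = xs := by simp
    have hX := P.isOpen_X.mem_nhds hxs
    have hx := line xs d 0
    have k1 : HasDerivAt (fun t : ℝ => grad S (xs + t • d) ⬝ᵥ d) (d ⬝ᵥ hess S xs *ᵥ d) 0 := by
      have hg : DifferentiableAt ℝ (grad S) (xs + (0 : ℝ) • d) := by
        rw [hz]; exact differentiableAt_grad (hS2.contDiffAt hX)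
      have := hasDerivAt_dotProduct (hasDerivAt_comp_jac hg hx) (hasDerivAt_const 0 d)
      rw [hz, dotProduct_zero, add_zero, mulVec_transpose, ← dotProduct_mulVec] at this
      exact this
    have k2 : HasDerivAt (fun t : ℝ => grad h (xs + t • d) ⬝ᵥ d) (d ⬝ᵥ hess h xs *ᵥ d) 0 := by
      have hg : DifferentiableAt ℝ (grad h) (xs + (0 : ℝ) • d) := by
        rw [hz]; exact differentiableAt_grad (hh2.contDiffAt hX)
      have := hasDerivAt_dotProduct (hasDerivAt_comp_jac hg hx) (hasDerivAt_const 0 d)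
      rw [hz, dotProduct_zero, add_zero, mulVec_transpose, ← dotProduct_mulVec] at this
      exact this
    set a := (jac γ xs)ᵀ *ᵥ d with ha
    have k3 : HasDerivAt (fun t : ℝ =>
        sat G.αc G.βc (γ (xs + t • d) - γ xs + (0 + t • e)) ⬝ᵥ ((jac γ (xs + t • d))ᵀ *ᵥ d + e))
        (∑ i, α i * β i * (a i + e i) ^ 2) 0 := by
      have hzc : HasDerivAt (fun t : ℝ => γ (xs + t • d) - γ xs + (0 + t • e)) (a + e) 0 := by
        have := ((hasDerivAt_comp_jac (by rw [hz]; exact hdγ _ hxs) hx).sub_const (γ xs)).add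
          (line 0 e 0)
        rw [hz] at this
        exact this
      have hσ := hasDerivAt_sat_of_eq_zero (a := G.αc) (b := G.βc) hzc (by simp)
      have hJ : DifferentiableAt ℝ (fun t : ℝ => (jac γ (xs + t • d))ᵀ *ᵥ d) 0 := by
        refine differentiableAt_pi.2 fun i => ?_
        have hγi : ContDiffAt ℝ 2 (fun x => γ x i) (xs + (0 : ℝ) • d) := by
          rw [hz]; exact contDiffAt_pi.1 (hγ2.contDiffAt hX) i
        exact (hasDerivAt_dotProduct (hasDerivAt_comp_jac (differentiableAt_grad hγi) hx)
          (hasDerivAt_const 0 d)).differentiableAt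
      refine (hasDerivAt_dotProduct hσ (hJ.hasDerivAt.add_const e)).congr_deriv ?_
      rw [hz, ← ha, hG.αc_eq, hG.βc_eq]
      simp only [sub_self, zero_smul, add_zero, sat_zero, zero_dotProduct]
      simp only [dotProduct, Pi.add_apply]
      exact Finset.sum_congr rfl fun i _ => by ring
    have k4 : HasDerivAt (fun t : ℝ => e ⬝ᵥ G.Kc *ᵥ (0 + t • e)) (e ⬝ᵥ G.Kc *ᵥ e) 0 := by
      simpa using hasDerivAt_dotProduct (hasDerivAt_const (0 : ℝ) e)
        (hasDerivAt_mulVec G.Kc (line 0 e 0))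
    have hval := (h4.congr_of_eventuallyEq hev.symm).unique (((k1.add k3).add k2).add k4)
    rw [hval]
    have hpos := quadratic_pos_of_schur h2.hessian _ hK₀ (d := d) (e := e) (by
      by_contra! hcon
      exact hv (by simp [hcon.1, hcon.2]))
    have hrank : d ⬝ᵥ (∑ i, (α i * β i) • vecMulVec (grad (fun x => γ x i) xs)
        (grad (fun x => γ x i) xs)) *ᵥ d = ∑ i, α i * β i * a i ^ 2 := by
      rw [sum_mulVec, dotProduct_sum]
      refine Finset.sum_congr rfl fun i _ => ?_
      rw [smul_mulVec, dotProduct_smul, vecMulVec_mulVec, ha, jac_transpose_mulVec_apply]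
      simp only [smul_dotProduct, dotProduct_comm d, op_smul_eq_smul, smul_eq_mul]
      ring
    have hcross : d ⬝ᵥ (jac γ xs * diagonal (α * β)) *ᵥ e = ∑ i, α i * β i * (a i * e i) := by
      rw [← mulVec_mulVec, dotProduct_mulVec, ← mulVec_transpose, ← ha]
      simp only [dotProduct, mulVec_diagonal, Pi.mul_apply]
      exact Finset.sum_congr rfl fun i _ => by ring
    rw [add_mulVec, add_mulVec, dotProduct_add, dotProduct_add, hrank, hcross] at hpos
    have hexp : ∑ i, α i * β i * (a i + e i) ^ 2 = ∑ i, α i * β i * a i ^ 2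
        + 2 * ∑ i, α i * β i * (a i * e i) + ∑ i, α i * β i * e i ^ 2 := by
      rw [Finset.mul_sum, ← Finset.sum_add_distrib, ← Finset.sum_add_distrib]
      exact Finset.sum_congr rfl fun i _ => by ring
    have hee : 0 ≤ ∑ i, α i * β i * e i ^ 2 := Finset.sum_nonneg fun i _ =>
      mul_nonneg (mul_pos (h2.α_pos i) (h2.β_pos i)).le (sq_nonneg _)
    rw [hexp]
    linarith

/-- `S_{dℓ}` has a strict minimum wherever `S_{dc}` does. -/
theorem eventually_Sdl_lt (hα : ∀ i, 0 < G.αl i) (hβ : ∀ i, 0 < G.βl i) (hk : ∀ i, 0 < G.kl i)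
    (h : ∀ᶠ p : (Fin n → ℝ) × (Fin m → ℝ) in 𝓝 (xs, 0), p ≠ (xs, 0) →
      Sdc P S γ xs G (xs, 0, 0) < Sdc P S γ xs G (p.1, 0, p.2)) :
    ∀ᶠ q : State n m in 𝓝 (xs, 0, 0), q ≠ (xs, 0, 0) →
      Sdl P S γ η xs G (xs, 0, 0) < Sdl P S γ η xs G q := by
  have hcont : ContinuousAt (fun q : State n m => (q.1, q.2.2)) (xs, 0, 0) := by fun_prop
  filter_upwards [hcont.eventually h] with q hq hne
  have h1 : Sdc P S γ xs G q = Sdc P S γ xs G (q.1, 0, q.2.2) := rfl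
  have h2 := logCosh_nonneg hα hβ (zl η xs G q)
  rw [Sdl, Sdl, zl_self, logCosh_zero, h1]
  by_cases hp : (q.1, q.2.2) = (xs, 0)
  · obtain ⟨hx, hξ⟩ := Prod.mk.inj hp
    have hl : q.2.1 ≠ 0 := fun hl => hne (Prod.ext hx (Prod.ext hl hξ))
    have hz : zl η xs G q ≠ 0 := by
      obtain ⟨i, hi⟩ := Function.ne_iff.1 hl
      refine Function.ne_iff.2 ⟨i, ?_⟩
      simpa [zl, hx, mulVec_diagonal, (hk i).ne'] using hi
    rw [hx, hξ]
    linarith [logCosh_pos hα hβ hz]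
  · linarith [hq hp]

end ClosedLoopAnalysis

end SatControl

namespace SatControl

theorem posDef_one_add_schur {m n : ℕ} {H : Matrix (Fin n) (Fin n) ℝ} (hH : H.PosDef)
    (B : Matrix (Fin n) (Fin m) ℝ) : (1 + Bᵀ * H⁻¹ * B).PosDef := by
  have h := hH.inv.posSemidef.conjTranspose_mul_mul_same B
  rw [conjTranspose_eq_transpose_of_trivial] at h
  exact PosDef.one.add_posSemidef h

section Conclusion

variable {n m r s : ℕ} {P : Plant n m} {S : (Fin n → ℝ) → ℝ} {l : (Fin n → ℝ) → Fin r → ℝ}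
  {w : (Fin n → ℝ) → Matrix (Fin r) (Fin m) ℝ} {D : (Fin n → ℝ) → Matrix (Fin m) (Fin m) ℝ}
  {γ : (Fin n → ℝ) → Fin m → ℝ} {η : (Fin n → ℝ) → Fin s → ℝ} {xs : Fin n → ℝ}
  {α β : Fin m → ℝ} {Λl : (Fin n → ℝ) → Fin s → ℝ} {Λc : (Fin n → ℝ) → Fin m → ℝ}
  {G : Gains m s}

theorem isLyapunovFunction_Sdl (h1 : P.Assumption1 S l) (h2 : P.Assumption2 S l w D γ α β xs)
    (h3 : P.Assumption3 S l w D γ η Λl Λc) (hG : G.Admissible α β)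
    (hmin : ∀ᶠ p : (Fin n → ℝ) × (Fin m → ℝ) in 𝓝 (xs, 0), p ≠ (xs, 0) →
      Sdc P S γ xs G (xs, 0, 0) < Sdc P S γ xs G (p.1, 0, p.2))
    (hΘ : ∀ᶠ x in 𝓝 xs, (Theta (Λl x) (Λc x) G.Υ G.kl G.rl).PosSemidef) :
    IsLyapunovFunction (closedLoop P γ η xs G) (stateSpace P) (xs, 0, 0)
      (Sdl P S γ η xs G) := by
  have hΘ' : ∀ᶠ q : State n m in 𝓝 (xs, 0, 0),
      (Theta (Λl q.1) (Λc q.1) G.Υ G.kl G.rl).PosSemidef :=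
    (continuous_fst.tendsto (xs, (0, 0))).eventually hΘ
  have hX : ∀ᶠ q : State n m in 𝓝 (xs, 0, 0), q ∈ stateSpace P :=
    isOpen_stateSpace.mem_nhds h2.assignable.1
  obtain ⟨N, hN, hNo, hpN⟩ := eventually_nhds_iff.1 (hX.and ((eventually_Sdl_lt (η := η) hG.αl_pos
    hG.βl_pos hG.kl_pos hmin).and hΘ'))
  refine ⟨N, hNo, hpN, fun q hq => (hN q hq).1, ?_, fun q hq => (hN q hq).2.1, fun q hq => ?_⟩
  · exact (contDiffOn_Sdl (h1.contDiffOn_S.of_le one_le_two) (h2.contDiffOn_γ.of_le one_le_two)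
      h3.contDiffOn_η).mono fun q hq => (hN q hq).1
  · refine (fderiv_Sdl_closedLoop_le h1 h2 h3 hG (hN q hq).1).trans ?_
    have e₁ := (hN q hq).2.2.dotProduct_mulVec_nonneg (Sum.elim (Sum.elim
      (P.rate η q.1 (control P γ η xs G q)) (P.output S l w D q.1 (control P γ η xs G q)))
      (xlDot η xs G q))
    have e₂ := hG.Rc_posDef.posSemidef.dotProduct_mulVec_nonneg
      (sat G.αc G.βc (zc γ xs q) + G.Kc *ᵥ q.2.2)
    rw [star_trivial] at e₁ e₂
    linarith

/-- Where `Θ` is positive definite, the storage is stationary only if the damped signals vanish. -/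
theorem eq_zero_of_fderiv_Sdl_closedLoop_eq_zero (h1 : P.Assumption1 S l)
    (h2 : P.Assumption2 S l w D γ α β xs) (h3 : P.Assumption3 S l w D γ η Λl Λc)
    (hG : G.Admissible α β) {q : State n m} (hq : q ∈ stateSpace P)
    (hΘ : (Theta (Λl q.1) (Λc q.1) G.Υ G.kl G.rl).PosDef)
    (hzero : fderiv ℝ (Sdl P S γ η xs G) q (closedLoop P γ η xs G q) = 0) :
    P.rate η q.1 (control P γ η xs G q) = 0 ∧
      P.output S l w D q.1 (control P γ η xs G q) = 0 ∧
      xlDot η xs G q = 0 ∧ xcDot γ xs G q = 0 := by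
  have hle := fderiv_Sdl_closedLoop_le h1 h2 h3 hG hq
  rw [hzero] at hle
  set e := Sum.elim (Sum.elim (P.rate η q.1 (control P γ η xs G q))
    (P.output S l w D q.1 (control P γ η xs G q))) (xlDot η xs G q) with he
  set φ := sat G.αc G.βc (zc γ xs q) + G.Kc *ᵥ q.2.2 with hφ
  have e₁ := hΘ.posSemidef.dotProduct_mulVec_nonneg e
  have e₂ := hG.Rc_posDef.posSemidef.dotProduct_mulVec_nonneg φ
  rw [star_trivial] at e₁ e₂
  have he0 : e = 0 := by
    by_contra hne
    have := hΘ.dotProduct_mulVec_pos hne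
    rw [star_trivial] at this
    linarith
  have hφ0 : φ = 0 := by
    by_contra hne
    have := hG.Rc_posDef.dotProduct_mulVec_pos hne
    rw [star_trivial] at this
    linarith
  refine ⟨funext fun i => congrFun he0 (.inl (.inl i)), funext fun i => congrFun he0 (.inl (.inr i)),
    funext fun i => congrFun he0 (.inr i), ?_⟩
  rw [xcDot, ← hφ, hφ0, mulVec_zero, neg_zero]

end Conclusion

end SatControl

theorem mainTheorem3 {n m r s : ℕ} (P : SatControl.Plant n m) (xs : Fin n → ℝ)
    (S : (Fin n → ℝ) → ℝ) (l : (Fin n → ℝ) → Fin r → ℝ)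
    (w : (Fin n → ℝ) → Matrix (Fin r) (Fin m) ℝ) (D : (Fin n → ℝ) → Matrix (Fin m) (Fin m) ℝ)
    (γ : (Fin n → ℝ) → Fin m → ℝ) (α β : Fin m → ℝ)
    (η : (Fin n → ℝ) → Fin s → ℝ) (Λl : (Fin n → ℝ) → Fin s → ℝ) (Λc : (Fin n → ℝ) → Fin m → ℝ)
    (h1 : P.Assumption1 S l) (h2 : P.Assumption2 S l w D γ α β xs)
    (h3 : P.Assumption3 S l w D γ η Λl Λc) :
    -- (i) saturation of the inputs, for all gains
    (∀ G : SatControl.Gains m s, G.Admissible α β →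
      ∀ q ∈ SatControl.stateSpace P, ∀ i,
        SatControl.control P γ η xs G q i ∈
          Set.Icc (-P.kappa xs i - G.αl i - G.αc i) (-P.kappa xs i + G.αl i + G.αc i)) ∧
    -- sufficiently large `K_ℓ R_ℓ` make `Θ` positive definite near `xs`
    (∀ Υ : Matrix (Fin m) (Fin s) ℝ, Υ.rank = min m s → ∃ c : ℝ, 0 < c ∧
      ∀ kl rl : Fin m → ℝ, (∀ i, 0 < kl i) → (∀ i, 0 < rl i) → (∀ i, c ≤ kl i * rl i) →
        ∀ᶠ x in 𝓝 xs, (SatControl.Theta (Λl x) (Λc x) Υ kl rl).PosDef) ∧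
    -- for all sufficiently large `K_c`:
    ∃ K₀ : Matrix (Fin m) (Fin m) ℝ, K₀.PosDef ∧
      ∀ G : SatControl.Gains m s, G.Admissible α β → (G.Kc - K₀).PosSemidef →
        -- (ii) stability with Lyapunov function `S_{dℓ}` if `Θ ≥ 0` near `xs`
        ((∀ᶠ x in 𝓝 xs, (SatControl.Theta (Λl x) (Λc x) G.Υ G.kl G.rl).PosSemidef) →
          SatControl.IsLyapunovFunction (SatControl.closedLoop P γ η xs G)
            (SatControl.stateSpace P) (xs, 0, 0) (SatControl.Sdl P S γ η xs G) ∧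
          SatControl.IsStableEquilibrium (SatControl.closedLoop P γ η xs G)
            (SatControl.stateSpace P) (xs, 0, 0)) ∧
        -- (iii) asymptotic stability if moreover `Θ > 0` near `xs` and detectability holds
        ((∀ᶠ x in 𝓝 xs, (SatControl.Theta (Λl x) (Λc x) G.Υ G.kl G.rl).PosDef) →
          ∀ Ω : Set (SatControl.State n m), IsOpen Ω → (xs, 0, 0) ∈ Ω →
            Ω ⊆ SatControl.stateSpace P →
            SatControl.Detectable P S l w D γ η xs G Ω →
            SatControl.IsAsympStableEquilibrium (SatControl.closedLoop P γ η xs G)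
              (SatControl.stateSpace P) (xs, 0, 0)) := by
  have hβ := h2.β_pos
  have hxs : xs ∈ P.X := h2.assignable.1
  refine ⟨fun G hG q hq i => ?_, fun Υ _ => ?_, ?_⟩
  · rw [SatControl.control_eq hG.βl_pos (hG.βc_pos hβ)]
    have e₁ := abs_le.1 (SatControl.abs_sat_le (b := G.βl) hG.αl_pos
      (SatControl.zl η xs G q) i)
    have e₂ := abs_le.1 (SatControl.abs_sat_le (b := G.βc) (hG.αc_pos h2.α_pos)
      (SatControl.zc γ xs q) i)
    simp only [Pi.sub_apply, Pi.neg_apply, Set.mem_Icc]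
    constructor <;> linarith [e₁.1, e₁.2, e₂.1, e₂.2]
  · have hX := P.isOpen_X.mem_nhds hxs
    obtain ⟨c, hc, h⟩ := SatControl.eventually_posDef_Theta
      (h3.continuousOn_Λl.continuousAt hX) (h3.continuousOn_Λc.continuousAt hX)
      (h3.Λl_pos xs hxs) (h3.Λc_pos xs hxs) Υ
    exact ⟨c, hc, fun kl rl _ hr hkr => h kl rl hr hkr⟩
  · refine ⟨_, SatControl.posDef_one_add_schur h2.hessian
      (SatControl.jac γ xs * diagonal (α * β)), fun G hG hK₀ => ?_⟩
    have hmin := SatControl.eventually_Sdc_lt h1 h2 hG hK₀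
    have hLyap := fun hΘ => SatControl.isLyapunovFunction_Sdl h1 h2 h3 hG hmin hΘ
    have hF := SatControl.contDiffOn_closedLoop (P := P) (xs := xs) hG.βl_pos (hG.βc_pos hβ)
      (h2.contDiffOn_γ.of_le one_le_two) h3.contDiffOn_η
    have h0 := SatControl.closedLoop_self (γ := γ) (η := η) hG.βl_pos (hG.βc_pos hβ) h2.assignable
    refine ⟨fun hΘ => ⟨hLyap hΘ, (hLyap hΘ).isStableEquilibrium
      SatControl.isOpen_stateSpace hF h0⟩, fun hΘ Ω hΩ hpΩ hΩX hdet => ?_⟩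
    have hΘ' : ∀ᶠ q : SatControl.State n m in 𝓝 (xs, 0, 0),
        (SatControl.Theta (Λl q.1) (Λc q.1) G.Υ G.kl G.rl).PosDef :=
      (continuous_fst.tendsto (xs, (0, 0))).eventually hΘ
    refine (hLyap (hΘ.mono fun x hx => hx.posSemidef)).isAsympStableEquilibrium
      SatControl.isOpen_stateSpace hF h0 (inter_mem (hΩ.mem_nhds hpΩ) hΘ') fun ζ hζ hzero => ?_
    refine hdet ζ ⟨hζ.1, fun t ht => (hζ.2 t ht).1⟩ (fun t ht => ?_) 0 self_mem_Ici
    exact SatControl.eq_zero_of_fderiv_Sdl_closedLoop_eq_zero h1 h2 h3 hG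
      (hΩX (hζ.2 t ht).1) (hζ.2 t ht).2 (hzero t ht)
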